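/- \textbf{Conventions.} $\mathcal H$ is a complex Hilbert space of arbitrary dimension, $\mathcal B(\mathcal H)_{\ge 0}$ is the set of bounded positive semi-definite (PSD) operators on it, $\le$ is the PSD order, $\mathcal S(\mathcal H)$ is the set of density operators (PSD operators of trace $1$), $\mathcal B(\mathcal H)_{[0,1]}=\{T:0\le T\le I\}$, and $\mathbb N=\{1,2,\dots\}$. For PSD operators $B,X$ the trace $\mathrm{Tr}\,X^{1/2}BX^{1/2}\in[0,+\infty]$ is always defined, and it equals $\mathrm{Tr}\,BX$ whenever $BX$ is trace-class. For a topological space $\mathcal Y$, $\mathcal S(\mathcal Y)$ is the set of Borel probability measures on $\mathcal Y$. We use $\log 0=-\infty$ and $\exp(-\infty)=0$. \textbf{Theorem.} Let $\mathcal Y$ be a non-empty compact Hausdorff space, let $\mathcal Y\ni y\mapsto A_y\in\mathcal B(\mathcal H)_{\ge0}$ be continuous in operator norm, and let $C\in\mathcal B(\mathcal H)_{\ge 0}$. For every $n\in\mathbb N$ let $\mathcal X_n\subseteq\mathcal B(\mathcal H^{\otimes n})_{\ge0}$ be such that (a) $A_y^{\otimes n}X$ and $C^{\otimes n}X$ are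 trace-class for all $y\in\mathcal Y$, $X\in\mathcal X_n$; (b) $X_1\otimes X_2\in\mathcal X_{n+m}$ for all $X_1\in\mathcal X_n$, $X_2\in\mathcal X_m$, $n,m\in\mathbb N$; (c) $y\mapsto\mathrm{Tr}\,A_y^{\otimes n}X$ is continuous for every $X\in\mathcal X_n$; (d) for all $S,T\in\mathcal B(\mathcal H^{\otimes n})_{\ge0}$ such that $SX$ and $TX$ are trace-class for every $X\in\mathcal X_n$, we have $S\le T$ if and only if $\mathrm{Tr}\,SX\le\mathrm{Tr}\,TX$ for all $X\in\mathcal X_n$. Assume moreover that for every $n\in\mathbb N$ there are a convex set $\tilde{\mathcal S}_n\subseteq\mathcal S(\mathcal H^{\otimes n})$ and a $\delta_n>0$ such that $\inf_{\varrho\in\tilde{\mathcal S}_n}\mathrm{Tr}\,\varrho Z=\inf\mathrm{spec}(Z)$ for all $Z\in\mathcal B(\mathcal H^{\otimes n})_{\ge0}$, and $$\tilde{\mathcal X}_n:=\{(C^{\otimes n}+\varepsilon I)^{-1/2}\varrho\,(C^{\otimes n}+\varepsilon I)^{-1/2}:\ \varrho\in\tilde{\mathcal S}_n,\ \varepsilon\in(0,\delta_n)\}\subseteq\mathcal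 X_n .$$ Then the following are equivalent: 1. For every $n\in\mathbb N$ and $X\in\mathcal B(\mathcal H^{\otimes n})_{\ge0}$, $\mathrm{Tr}\,X^{1/2}C^{\otimes n}X^{1/2}\le\sup_{y}\mathrm{Tr}\,X^{1/2}A_y^{\otimes n}X^{1/2}$. 2. For every $n\in\mathbb N$ and $X\in\mathcal X_n$, $\mathrm{Tr}\,C^{\otimes n}X\le\sup_y\mathrm{Tr}\,A_y^{\otimes n}X$. 3. For every $n\in\mathbb N$ and $X\in\tilde{\mathcal X}_n$, $\mathrm{Tr}\,C^{\otimes n}X\le\sup_y\mathrm{Tr}\,A_y^{\otimes n}X$. 4. For every $n\in\mathbb N$ there is a $\mu_n\in\mathcal S(\mathcal Y)$ with $C^{\otimes n}\le\int_{\mathcal Y}A_y^{\otimes n}\,d\mu_n(y)$. 5. There is a $\mu\in\mathcal S(\mathcal Y)$ with $C^{\otimes n}\le\int_{\mathcal Y}A_y^{\otimes n}\,d\mu(y)$ for all $n\in\mathbb N$. 6. There is a $\nu\in\mathcal S(\mathcal Y)$ with $\mathrm{Tr}\,C^{\otimes n}X\le\exp\left(\int_{\mathcal Y}\log\mathrm{Tr}\,A_y^{\otimes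 n}X\,d\nu(y)\right)$ for all $n\in\mathbb N$ and $X\in\mathcal X_n$. \textbf{Corollary.} Let $\mathcal R\subseteq\mathcal S(\mathcal H)$ be non-empty and compact in the operator norm (on $\mathcal S(\mathcal H)$ the operator norm and the trace norm induce the same topology), and let $C\in\mathcal B(\mathcal H)_{\ge0}$. In this part, $\mathrm{Tr}\,BX$ for PSD $B,X$ stands for $\mathrm{Tr}\,X^{1/2}BX^{1/2}\in[0,+\infty]$. Then the following are equivalent: 1. $C\in\mathcal C(\mathcal R)$, i.e., there are $\kappa_n\in(0,+\infty)$, $n\in\mathbb N$, with $\limsup_{n\to\infty}\frac1n\log\kappa_n\le0$ and $\mathrm{Tr}\,C^{\otimes n}T\le\kappa_n\sup_{\omega\in\mathcal R}\mathrm{Tr}\,\omega^{\otimes n}T$ for all $T\in\mathcal B(\mathcal H^{\otimes n})_{[0,1]}$ and $n\in\mathbb N$. 2. $\mathrm{Tr}\,C^{\otimes n}T\le\sup_{\omega\in\mathcal R}\mathrm{Tr}\,\omega^{\otimes n}T$ for all $T\in\mathcal B(\mathcal H^{\otimes n})_{[0,1]}$ and $n\in\mathbb N$. 3. There is a $\mu\in\mathcal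 S(\mathcal R)$ with $C^{\otimes n}\le\int_{\mathcal R}\omega^{\otimes n}\,d\mu(\omega)$ for all $n\in\mathbb N$. 4. There is a $\nu\in\mathcal S(\mathcal R)$ with $\mathrm{Tr}\,C^{\otimes n}X\le\exp\left(\int_{\mathcal R}\log\mathrm{Tr}\,\omega^{\otimes n}X\,d\nu(\omega)\right)$ for all $X\in\mathcal B(\mathcal H^{\otimes n})_{\ge0}$ and $n\in\mathbb N$. -/

import Mathlib

open scoped TensorProduct ENNReal InnerProductSpace
open UniformSpace MeasureTheory Filter

universe u v

noncomputable section

namespace WeakMean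

/-! ### Trace of operators on a (possibly infinite-dimensional) complex Hilbert space -/

section Trace

variable (K : Type u) [NormedAddCommGroup K] [InnerProductSpace ℂ K] [CompleteSpace K]

/-- The index set of a fixed Hilbert basis (complete orthonormal system) of `K`. -/
def basisIndex : Set K := (exists_hilbertBasis ℂ K).choose

/-- A fixed Hilbert basis of `K`, used to compute traces. -/
def stdBasis : HilbertBasis (basisIndex K) ℂ K := (exists_hilbertBasis ℂ K).choose_spec.choose

variable {K}

/-- The trace `∑ ⟨eᵢ, A eᵢ⟩ ∈ [0, ∞]` of a positive semi-definite operator `A`. -/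
def psdTrace (A : K →L[ℂ] K) : ℝ≥0∞ :=
  ∑' i, ENNReal.ofReal (⟪stdBasis K i, A (stdBasis K i)⟫_ℂ).re

/-- `T` is trace-class: `Tr |T| < ∞`, where `|T| = (T* T)^{1/2}`. -/
def IsTraceClass (T : K →L[ℂ] K) : Prop := psdTrace (CFC.abs T) < ∞

/-- The trace `∑ ⟨eᵢ, T eᵢ⟩` of a trace-class operator `T`. -/
def tr (T : K →L[ℂ] K) : ℂ := ∑' i, ⟪stdBasis K i, T (stdBasis K i)⟫_ℂ

/-- `Tr X^{1/2} A X^{1/2} ∈ [0, ∞]` for positive semi-definite operators `A`, `X`. -/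
def sandwichTrace (A X : K →L[ℂ] K) : ℝ≥0∞ := psdTrace (CFC.sqrt X * A * CFC.sqrt X)

variable (K) in
/-- The set `𝒮(K)` of density operators: positive semi-definite operators of trace one. -/
def densityOperators : Set (K →L[ℂ] K) := {ρ | 0 ≤ ρ ∧ psdTrace ρ = 1}

end Trace

/-! ### Hilbert space tensor products and tensor powers -/

section Tensor

/-- The Hilbert space tensor product: completion of the algebraic tensor product. -/
abbrev HTensor (E F : Type*) [NormedAddCommGroup E] [InnerProductSpace ℂ E]
    [NormedAddCommGroup F] [InnerProductSpace ℂ F] : Type _ :=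
  Completion (E ⊗[ℂ] F)

/-- The tensor product `S ⊗ T` of two bounded operators, on the Hilbert space tensor product. -/
def opTensor {E F : Type*} [NormedAddCommGroup E] [InnerProductSpace ℂ E]
    [NormedAddCommGroup F] [InnerProductSpace ℂ F] (S : E →L[ℂ] E) (T : F →L[ℂ] F) :
    HTensor E F →L[ℂ] HTensor E F :=
  (TensorProduct.mapL S T).completion

/-- A complex inner product space, bundled, as needed to define tensor powers by recursion. -/
structure InnerSpace : Type (u + 1) where
  carrier : Type u
  [normed : NormedAddCommGroup carrier]
  [inner : InnerProductSpace ℂ carrier]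

attribute [instance] InnerSpace.normed InnerSpace.inner

variable (H : Type u) [NormedAddCommGroup H] [InnerProductSpace ℂ H]

/-- Recursion behind `AlgPow`; the zeroth power is the one-dimensional Hilbert space. -/
def algPowAux : ℕ → InnerSpace.{u}
  | 0 => ⟨EuclideanSpace ℂ PUnit.{u + 1}⟩
  | n + 1 => ⟨(algPowAux n).carrier ⊗[ℂ] H⟩

/-- The `n`-fold algebraic tensor power of `H`, with
`⟨x₁ ⊗ ⋯ ⊗ xₙ, y₁ ⊗ ⋯ ⊗ yₙ⟩ = ∏ ⟨xᵢ, yᵢ⟩`. -/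
def AlgPow (n : ℕ) : Type u := (algPowAux H n).carrier

instance (n : ℕ) : NormedAddCommGroup (AlgPow H n) := (algPowAux H n).normed
instance (n : ℕ) : InnerProductSpace ℂ (AlgPow H n) := (algPowAux H n).inner

/-- The identification `H^{⊗ (n+1)} = H^{⊗ n} ⊗ H` (algebraic tensor powers). -/
def algSucc (n : ℕ) : AlgPow H (n + 1) ≃ₗᵢ[ℂ] AlgPow H n ⊗[ℂ] H :=
  LinearIsometryEquiv.refl ℂ (AlgPow H n ⊗[ℂ] H)

/-- The zeroth tensor power is `ℂ`. -/
def algZero : AlgPow H 0 ≃ₗᵢ[ℂ] ℂ :=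
  (OrthonormalBasis.singleton PUnit.{u + 1} ℂ).repr.symm

/-- The `n`-th tensor power `H^{⊗ n}` of the Hilbert space `H`. -/
abbrev HilbertPow (n : ℕ) : Type u := Completion (AlgPow H n)

variable {H}

/-- `A ⊗ ⋯ ⊗ A` on the algebraic tensor power. -/
def algOpPow (A : H →L[ℂ] H) : (n : ℕ) → (AlgPow H n →L[ℂ] AlgPow H n)
  | 0 => ContinuousLinearMap.id ℂ _
  | n + 1 => ((algSucc H n).symm : AlgPow H n ⊗[ℂ] H →L[ℂ] AlgPow H (n + 1)) ∘L
      TensorProduct.mapL (algOpPow A n) A ∘L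
      ((algSucc H n) : AlgPow H (n + 1) →L[ℂ] AlgPow H n ⊗[ℂ] H)

/-- The tensor power `A^{⊗ n}`, a bounded operator on `H^{⊗ n}`. -/
def opPow (A : H →L[ℂ] H) (n : ℕ) : HilbertPow H n →L[ℂ] HilbertPow H n := (algOpPow A n).completion

variable (H)

/-- The juxtaposition isomorphism `H^{⊗ n} ⊗ H^{⊗ m} ≅ H^{⊗ (n+m)}` (algebraic tensor powers). -/
def algAppend (n : ℕ) : (m : ℕ) → (AlgPow H n ⊗[ℂ] AlgPow H m ≃ₗᵢ[ℂ] AlgPow H (n + m))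
  | 0 => (TensorProduct.congrIsometry (.refl ℂ (AlgPow H n)) (algZero H)).trans
      (TensorProduct.ridIsometry ℂ (AlgPow H n))
  | m + 1 => ((TensorProduct.congrIsometry (.refl ℂ (AlgPow H n)) (algSucc H m)).trans
      (TensorProduct.assocIsometry ℂ (AlgPow H n) (AlgPow H m) H).symm).trans
      ((TensorProduct.congrIsometry (algAppend n m) (.refl ℂ H)).trans (algSucc H (n + m)).symm)

/-- The canonical isometric map from the algebraic tensor product of two inner product spaces to
the Hilbert space tensor product of their completions. -/
def toHTensor (E F : Type*) [NormedAddCommGroup E] [InnerProductSpace ℂ E]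
    [NormedAddCommGroup F] [InnerProductSpace ℂ F] :
    E ⊗[ℂ] F →ₗᵢ[ℂ] HTensor (Completion E) (Completion F) :=
  Completion.toComplₗᵢ.comp
    (TensorProduct.mapIsometry Completion.toComplₗᵢ Completion.toComplₗᵢ)

theorem denseRange_toHTensor (E F : Type*) [NormedAddCommGroup E] [InnerProductSpace ℂ E]
    [NormedAddCommGroup F] [InnerProductSpace ℂ F] : DenseRange (toHTensor E F) := by
  have h : DenseRange (TensorProduct.mapIsometry (𝕜 := ℂ)
      (Completion.toComplₗᵢ (𝕜 := ℂ) (E := E)) (Completion.toComplₗᵢ (𝕜 := ℂ) (E := F))) := by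
    set f := TensorProduct.mapIsometry (𝕜 := ℂ)
      (Completion.toComplₗᵢ (𝕜 := ℂ) (E := E)) (Completion.toComplₗᵢ (𝕜 := ℂ) (E := F)) with hf
    have key : ∀ z, z ∈ (LinearMap.range f.toLinearMap).topologicalClosure := by
      intro z
      induction z using TensorProduct.induction_on with
      | zero => exact Submodule.zero_mem _
      | add x y hx hy => exact Submodule.add_mem _ hx hy
      | tmul x y =>
        refine Completion.induction_on₂ x y ?_ ?_
        · exact (Submodule.isClosed_topologicalClosure _).preimage
            (TensorProduct.continuous_tmul (𝕜 := ℂ))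
        · intro a b
          exact Submodule.le_topologicalClosure _ ⟨a ⊗ₜ b, by simp [hf]⟩
    intro z
    exact key z
  exact Completion.denseRange_coe.comp h (Completion.continuous_coe _)

/-- The juxtaposition isomorphism `H^{⊗ n} ⊗ H^{⊗ m} ≅ H^{⊗ (n+m)}` of Hilbert spaces. -/
def append (n m : ℕ) : HTensor (HilbertPow H n) (HilbertPow H m) ≃ₗᵢ[ℂ] HilbertPow H (n + m) :=
  (algAppend H n m).toLinearEquiv.extendOfIsometry
    (toHTensor (AlgPow H n) (AlgPow H m)).toLinearMap
    (Completion.toComplₗᵢ (𝕜 := ℂ) (E := AlgPow H (n + m))).toLinearMap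
    (denseRange_toHTensor _ _) Completion.denseRange_coe (by intro x; simp)

variable {H}

/-- For `S` on `H^{⊗ n}` and `T` on `H^{⊗ m}`, the operator `S ⊗ T` on `H^{⊗ (n+m)}`. -/
def powTensor {n m : ℕ} (S : HilbertPow H n →L[ℂ] HilbertPow H n) (T : HilbertPow H m →L[ℂ] HilbertPow H m) :
    HilbertPow H (n + m) →L[ℂ] HilbertPow H (n + m) :=
  ((append H n m) : HTensor (HilbertPow H n) (HilbertPow H m) →L[ℂ] HilbertPow H (n + m)) ∘L
    opTensor S T ∘L
    ((append H n m).symm : HilbertPow H (n + m) →L[ℂ] HTensor (HilbertPow H n) (HilbertPow H m))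

end Tensor

/-! ### Geometric means of functions, with `log 0 = -∞` and `exp (-∞) = 0` -/

section GeomMean

variable {Y : Type v} [MeasurableSpace Y]

/-- The integral `∫ g⁺ dν - ∫ g⁻ dν` of an extended real valued function. -/
def extIntegral (ν : Measure Y) (g : Y → EReal) : EReal :=
  ((∫⁻ y, (g y).toENNReal ∂ν : ℝ≥0∞) : EReal) - ((∫⁻ y, (-g y).toENNReal ∂ν : ℝ≥0∞) : EReal)

/-- The weighted geometric mean `exp (∫ log f dν)` of a function `f : Y → [0, ∞]`. -/
def geomMean (ν : Measure Y) (f : Y → ℝ≥0∞) : ℝ≥0∞ :=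
  EReal.exp (extIntegral ν fun y => ENNReal.log (f y))

end GeomMean

/-! ### The setting of the weak bounds -/

section Setting

variable {H : Type u} [NormedAddCommGroup H] [InnerProductSpace ℂ H]

/-- The standing assumptions on the sets `𝒳 n` of positive semi-definite operators on `H^{⊗ n}`,
`n ≥ 1`. -/
structure TraceAssumption {Y : Type v} [TopologicalSpace Y] (A : Y → (H →L[ℂ] H))
    (C : H →L[ℂ] H) (𝒳 : (n : ℕ) → Set (HilbertPow H n →L[ℂ] HilbertPow H n)) : Prop where
  nonneg : ∀ n, 1 ≤ n → ∀ X ∈ 𝒳 n, 0 ≤ X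
  traceClass_family : ∀ n, 1 ≤ n → ∀ X ∈ 𝒳 n, ∀ y, IsTraceClass (opPow (A y) n * X)
  traceClass_bound : ∀ n, 1 ≤ n → ∀ X ∈ 𝒳 n, IsTraceClass (opPow C n * X)
  tensor_mem : ∀ n m, 1 ≤ n → 1 ≤ m → ∀ X₁ ∈ 𝒳 n, ∀ X₂ ∈ 𝒳 m, powTensor X₁ X₂ ∈ 𝒳 (n + m)
  continuous_trace : ∀ n, 1 ≤ n → ∀ X ∈ 𝒳 n, Continuous fun y => tr (opPow (A y) n * X)

/-- The set `𝒳` of positive semi-definite operators characterizes the positive semi-definite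
order: `S ≤ T` iff `Tr S X ≤ Tr T X` for all `X ∈ 𝒳`, whenever `S, T ≥ 0` are such that all these
traces are defined. -/
def CharacterizesOrder {K : Type u} [NormedAddCommGroup K] [InnerProductSpace ℂ K]
    [CompleteSpace K] (𝒳 : Set (K →L[ℂ] K)) : Prop :=
  ∀ S T : K →L[ℂ] K, 0 ≤ S → 0 ≤ T →
    (∀ X ∈ 𝒳, IsTraceClass (S * X) ∧ IsTraceClass (T * X)) →
    (S ≤ T ↔ ∀ X ∈ 𝒳, (tr (S * X)).re ≤ (tr (T * X)).re)

/-- `inf_{ρ ∈ 𝒮} Tr ρ Z = inf spec Z` for all positive semi-definite `Z`. -/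
def AttainsInfSpec {K : Type u} [NormedAddCommGroup K] [InnerProductSpace ℂ K]
    [CompleteSpace K] (𝒮 : Set (K →L[ℂ] K)) : Prop :=
  ∀ Z : K →L[ℂ] K, 0 ≤ Z → sInf ((fun ρ => (tr (ρ * Z)).re) '' 𝒮) = sInf (spectrum ℝ Z)

/-- The set `{(D + ε I)^{-1/2} ρ (D + ε I)^{-1/2} : ρ ∈ 𝒮, ε ∈ (0, δ)}`. -/
def rescaled {K : Type u} [NormedAddCommGroup K] [InnerProductSpace ℂ K] [CompleteSpace K]
    (D : K →L[ℂ] K) (𝒮 : Set (K →L[ℂ] K)) (δ : ℝ) : Set (K →L[ℂ] K) :=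
  {X | ∃ ρ ∈ 𝒮, ∃ ε ∈ Set.Ioo 0 δ,
    X = (D + ε • (1 : K →L[ℂ] K)) ^ (-(1 / 2) : ℝ) * ρ *
      (D + ε • (1 : K →L[ℂ] K)) ^ (-(1 / 2) : ℝ)}

/-- The set `𝒞(ℛ)` of operators `C ≥ 0` for which there are `κₙ ∈ (0, ∞)` with
`Tr C^{⊗ n} T ≤ κₙ sup_{ω ∈ ℛ} Tr ω^{⊗ n} T` for all tests `0 ≤ T ≤ I` on `H^{⊗ n}`, `n ≥ 1`, and
`limsup (1/n) log κₙ ≤ 0`. Traces of products of positive semi-definite operators are taken in the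
form `Tr T^{1/2} A T^{1/2} ∈ [0, ∞]`, which equals `Tr A T` if `A T` is trace-class. -/
def dominatedOperators [CompleteSpace H] (R : Set (H →L[ℂ] H)) : Set (H →L[ℂ] H) :=
  {C | 0 ≤ C ∧ ∃ κ : ℕ → ℝ, (∀ n, 1 ≤ n → 0 < κ n) ∧
    (∀ n, 1 ≤ n → ∀ T : HilbertPow H n →L[ℂ] HilbertPow H n, 0 ≤ T → T ≤ 1 →
      sandwichTrace (opPow C n) T ≤
        ENNReal.ofReal (κ n) * ⨆ ω ∈ R, sandwichTrace (opPow ω n) T) ∧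
    limsup (fun n : ℕ => ((1 / (n : ℝ) * Real.log (κ n) : ℝ) : EReal)) atTop ≤ 0}

end Setting

end WeakMean

end

open WeakMean

/-! The analytic core is one separation principle, `exists_probabilityMeasure_integral_nonneg`. If
no element of an additive monoid of continuous functions on `Y` is strictly negative, then rounding
real coefficients to integers shows that no convex combination is either. Hahn-Banach and
Riesz-Markov then give a single probability measure under which every element has non-negative
integral.

The principle is used twice. Applied to the functions `log (Tr A_y^{⊗n} X + ε) - log Tr C^{⊗n} X`,
it yields one geometric-mean measure for all `n` at once (`exists_le_geomMean`): traces are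
multiplicative on tensor products (`sandwichTrace_powTensor`), so a sum of such functions is
controlled by the single test operator `X₁ ⊗ X₂ ⊗ ⋯`. Applied for fixed `n` to differences of
traces, where convexity of `𝒮 n` plays the role of multiplicativity, it yields an arithmetic-mean
measure (`exists_probabilityMeasure_le_integral`).

Jensen's inequality (`geomMean_le_lintegral`) passes from the geometric to the arithmetic mean.
Operator inequalities are recovered from scalar ones because densities see the bottom of the
spectrum and the rescaling by `(C^{⊗n} + ε)^{-1/2}` is invertible (`le_of_forall_density`). An
operator inequality implies the trace bounds because a trace of an average is at most the supremum
(`sandwichTrace_integral_le`). In infinite dimension one must also know that `Tr BX` and `Tr X^{1/2}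
B X^{1/2}` agree whenever `BX` is trace-class (`IsTraceClass.sandwichTrace_eq`).

For the corollary, the tensor power trick removes the factors `κ_n`. On density operators, norm
convergence makes traces against bounded operators continuous, and rank-one test operators recover
the operator order. -/

namespace WeakMean

open ContinuousLinearMap

/-! ### Hilbert-Schmidt norms and traces of positive operators. -/

section HilbertSchmidt

variable {K L ι κ : Type*} [NormedAddCommGroup K] [InnerProductSpace ℂ K]
  [NormedAddCommGroup L] [InnerProductSpace ℂ L]

theorem tsum_enorm_inner_sq (b : HilbertBasis ι ℂ K) (x : K) :
    ∑' i, ‖⟪b i, x⟫_ℂ‖ₑ ^ 2 = ‖x‖ₑ ^ 2 := by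
  have h := b.hasSum_inner_mul_inner x x
  have h2 : HasSum (fun i => ‖⟪b i, x⟫_ℂ‖ ^ 2) (‖x‖ ^ 2) := by
    have := (Complex.hasSum_re h)
    convert this using 1
    · ext i
      rw [← inner_conj_symm x (b i), mul_comm, Complex.mul_conj, Complex.ofReal_re,
        Complex.normSq_eq_norm_sq]
    · exact (inner_self_eq_norm_sq (𝕜 := ℂ) x).symm
  have h3 := ENNReal.ofReal_tsum_of_nonneg (fun i => sq_nonneg ‖⟪b i, x⟫_ℂ‖) h2.summable
  rw [h2.tsum_eq] at h3
  simp only [ENNReal.ofReal_pow (norm_nonneg _), ofReal_norm] at h3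
  exact h3.symm

/-- Parseval turns both sides into the same double sum of non-negative matrix entries. As the two
bases are unrelated, this also gives basis independence of the Hilbert-Schmidt norm. -/
theorem tsum_enorm_sq_adjoint [CompleteSpace K] [CompleteSpace L] (b : HilbertBasis ι ℂ K)
    (c : HilbertBasis κ ℂ L) (P : K →L[ℂ] L) :
    ∑' i, ‖P (b i)‖ₑ ^ 2 = ∑' j, ‖adjoint P (c j)‖ₑ ^ 2 := by
  calc ∑' i, ‖P (b i)‖ₑ ^ 2 = ∑' i, ∑' j, ‖⟪c j, P (b i)⟫_ℂ‖ₑ ^ 2 := by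
        simp only [tsum_enorm_inner_sq]
    _ = ∑' j, ∑' i, ‖⟪c j, P (b i)⟫_ℂ‖ₑ ^ 2 := ENNReal.tsum_comm
    _ = ∑' j, ∑' i, ‖⟪b i, adjoint P (c j)⟫_ℂ‖ₑ ^ 2 := by
        refine tsum_congr fun j => tsum_congr fun i => ?_
        rw [adjoint_inner_right, ← inner_conj_symm, RCLike.enorm_conj]
    _ = _ := by simp only [tsum_enorm_inner_sq]

variable [CompleteSpace K]

/-- The square of the Hilbert-Schmidt norm. -/
noncomputable def hsSq (P : K →L[ℂ] L) : ℝ≥0∞ := ∑' i, ‖P (stdBasis K i)‖ₑ ^ 2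

theorem hsSq_eq_tsum [CompleteSpace L] (b : HilbertBasis ι ℂ K) (P : K →L[ℂ] L) :
    hsSq P = ∑' i, ‖P (b i)‖ₑ ^ 2 := by
  rw [hsSq, tsum_enorm_sq_adjoint _ (stdBasis L), tsum_enorm_sq_adjoint _ (stdBasis L)]

theorem hsSq_adjoint [CompleteSpace L] (P : K →L[ℂ] L) : hsSq (adjoint P) = hsSq P :=
  (tsum_enorm_sq_adjoint (stdBasis K) (stdBasis L) P).symm

theorem hsSq_star (P : K →L[ℂ] K) : hsSq (star P) = hsSq P := hsSq_adjoint P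

theorem hsSq_mul_le (P Q : K →L[ℂ] K) : hsSq (P * Q) ≤ ‖P‖ₑ ^ 2 * hsSq Q := by
  rw [hsSq, hsSq, ← ENNReal.tsum_mul_left]
  refine ENNReal.tsum_le_tsum fun i => ?_
  rw [← mul_pow]
  gcongr
  exact P.le_opENorm _

theorem psdTrace_star_mul_self (P : K →L[ℂ] K) : psdTrace (star P * P) = hsSq P := by
  refine tsum_congr fun i => ?_
  rw [mul_apply_eq_comp, star_eq_adjoint, adjoint_inner_right]
  rw [← ofReal_norm, ← ENNReal.ofReal_pow (norm_nonneg _)]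
  congr 1
  exact inner_self_eq_norm_sq (𝕜 := ℂ) _

theorem isSelfAdjoint_sqrt (A : K →L[ℂ] K) : star (CFC.sqrt A) = CFC.sqrt A :=
  (IsSelfAdjoint.of_nonneg (CFC.sqrt_nonneg A)).star_eq

theorem psdTrace_eq_hsSq_sqrt {A : K →L[ℂ] K} (hA : 0 ≤ A) : psdTrace A = hsSq (CFC.sqrt A) := by
  rw [← psdTrace_star_mul_self, isSelfAdjoint_sqrt, CFC.sqrt_mul_sqrt_self A]

theorem sandwichTrace_eq_hsSq {A : K →L[ℂ] K} (hA : 0 ≤ A) (X : K →L[ℂ] K) :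
    sandwichTrace A X = hsSq (CFC.sqrt A * CFC.sqrt X) := by
  rw [← psdTrace_star_mul_self, star_mul, isSelfAdjoint_sqrt, isSelfAdjoint_sqrt, sandwichTrace,
    mul_assoc, mul_assoc, ← mul_assoc (CFC.sqrt A), CFC.sqrt_mul_sqrt_self A]

/-- The two sides are the squared Hilbert-Schmidt norms of `√A √X` and of its adjoint. -/
theorem sandwichTrace_comm {A X : K →L[ℂ] K} (hA : 0 ≤ A) (hX : 0 ≤ X) :
    sandwichTrace A X = sandwichTrace X A := by
  rw [sandwichTrace_eq_hsSq hA, sandwichTrace_eq_hsSq hX, ← hsSq_star, star_mul,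
    isSelfAdjoint_sqrt, isSelfAdjoint_sqrt]

omit [CompleteSpace K] in
theorem re_inner_nonneg {A : K →L[ℂ] K} (hA : 0 ≤ A) (x : K) : 0 ≤ (⟪x, A x⟫_ℂ).re :=
  ((nonneg_iff_isPositive A).1 hA).re_inner_nonneg_right x

theorem psdTrace_add {A B : K →L[ℂ] K} (hA : 0 ≤ A) (hB : 0 ≤ B) :
    psdTrace (A + B) = psdTrace A + psdTrace B := by
  rw [psdTrace, psdTrace, psdTrace, ← ENNReal.tsum_add]
  refine tsum_congr fun i => ?_
  rw [add_apply, inner_add_right, Complex.add_re,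
    ENNReal.ofReal_add (re_inner_nonneg hA _) (re_inner_nonneg hB _)]

theorem psdTrace_mono {A B : K →L[ℂ] K} (h : A ≤ B) : psdTrace A ≤ psdTrace B := by
  refine ENNReal.tsum_le_tsum fun i => ENNReal.ofReal_le_ofReal ?_
  have := re_inner_nonneg (sub_nonneg.2 h) (stdBasis K i)
  rw [sub_apply, inner_sub_right, Complex.sub_re] at this
  linarith

theorem psdTrace_smul {c : ℝ} (hc : 0 ≤ c) (A : K →L[ℂ] K) :
    psdTrace (c • A) = ENNReal.ofReal c * psdTrace A := by
  rw [psdTrace, psdTrace, ← ENNReal.tsum_mul_left]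
  refine tsum_congr fun i => ?_
  rw [← ENNReal.ofReal_mul hc, FunLike.coe_smul, Pi.smul_apply, ← Complex.coe_smul, inner_smul_right,
    Complex.re_ofReal_mul]

theorem sqrt_conj_nonneg {A : K →L[ℂ] K} (hA : 0 ≤ A) (X : K →L[ℂ] K) :
    0 ≤ CFC.sqrt X * A * CFC.sqrt X :=
  (IsSelfAdjoint.of_nonneg (CFC.sqrt_nonneg X)).conjugate_nonneg hA

theorem sandwichTrace_add_left {A B : K →L[ℂ] K} (hA : 0 ≤ A) (hB : 0 ≤ B) (X : K →L[ℂ] K) :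
    sandwichTrace (A + B) X = sandwichTrace A X + sandwichTrace B X := by
  rw [sandwichTrace, mul_add, add_mul,
    psdTrace_add (sqrt_conj_nonneg hA X) (sqrt_conj_nonneg hB X)]
  rfl

theorem sandwichTrace_mono_left {A B : K →L[ℂ] K} (h : A ≤ B) (X : K →L[ℂ] K) :
    sandwichTrace A X ≤ sandwichTrace B X :=
  psdTrace_mono ((IsSelfAdjoint.of_nonneg (CFC.sqrt_nonneg X)).conjugate_le_conjugate h)

theorem sandwichTrace_smul_left {c : ℝ} (hc : 0 ≤ c) (A X : K →L[ℂ] K) :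
    sandwichTrace (c • A) X = ENNReal.ofReal c * sandwichTrace A X := by
  rw [sandwichTrace, mul_smul_comm, smul_mul_assoc, psdTrace_smul hc]
  rfl

theorem sandwichTrace_one_left {X : K →L[ℂ] K} (hX : 0 ≤ X) : sandwichTrace 1 X = psdTrace X := by
  rw [sandwichTrace, mul_one, CFC.sqrt_mul_sqrt_self X]

theorem sandwichTrace_add_right {A X Y : K →L[ℂ] K} (hA : 0 ≤ A) (hX : 0 ≤ X) (hY : 0 ≤ Y) :
    sandwichTrace A (X + Y) = sandwichTrace A X + sandwichTrace A Y := by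
  rw [sandwichTrace_comm hA (add_nonneg hX hY), sandwichTrace_add_left hX hY,
    sandwichTrace_comm hX hA, sandwichTrace_comm hY hA]

theorem sandwichTrace_smul_right {c : ℝ} (hc : 0 ≤ c) {A X : K →L[ℂ] K} (hA : 0 ≤ A)
    (hX : 0 ≤ X) : sandwichTrace A (c • X) = ENNReal.ofReal c * sandwichTrace A X := by
  rw [sandwichTrace_comm hA (smul_nonneg hc hX), sandwichTrace_smul_left hc,
    sandwichTrace_comm hX hA]

/-- Both sides are squared Hilbert-Schmidt norms, of `√X R √A` and of its adjoint. This lets the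
rescaling `R` move from the density onto the operator being tested. -/
theorem sandwichTrace_conj {A X R : K →L[ℂ] K} (hA : 0 ≤ A) (hX : 0 ≤ X) (hR : IsSelfAdjoint R) :
    sandwichTrace A (R * X * R) = sandwichTrace (R * A * R) X := by
  rw [sandwichTrace_comm hA (hR.conjugate_nonneg hX), sandwichTrace, sandwichTrace]
  have h1 : CFC.sqrt A * (R * X * R) * CFC.sqrt A =
      star (CFC.sqrt X * R * CFC.sqrt A) * (CFC.sqrt X * R * CFC.sqrt A) := by
    simp only [star_mul, isSelfAdjoint_sqrt, hR.star_eq, mul_assoc]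
    rw [← mul_assoc (CFC.sqrt X) (CFC.sqrt X), CFC.sqrt_mul_sqrt_self X]
  have h2 : CFC.sqrt X * (R * A * R) * CFC.sqrt X =
      star (CFC.sqrt A * R * CFC.sqrt X) * (CFC.sqrt A * R * CFC.sqrt X) := by
    simp only [star_mul, isSelfAdjoint_sqrt, hR.star_eq, mul_assoc]
    rw [← mul_assoc (CFC.sqrt A) (CFC.sqrt A), CFC.sqrt_mul_sqrt_self A]
  rw [h1, h2, psdTrace_star_mul_self, psdTrace_star_mul_self, ← hsSq_star]
  simp only [star_mul, isSelfAdjoint_sqrt, hR.star_eq, mul_assoc]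

theorem summable_of_hsSq {P : K →L[ℂ] L} (hP : hsSq P ≠ ∞) :
    Summable fun i => ‖P (stdBasis K i)‖ ^ 2 := by
  have := ENNReal.summable_toReal hP
  simpa using this

omit [CompleteSpace K] in
theorem summable_inner_sq (b : HilbertBasis ι ℂ K) {T : κ → K}
    (hT : ∑' k, ‖T k‖ₑ ^ 2 ≠ ∞) : Summable fun p : κ × ι => ‖⟪b p.2, T p.1⟫_ℂ‖ ^ 2 := by
  have h1 : ∑' p : κ × ι, ‖⟪b p.2, T p.1⟫_ℂ‖ₑ ^ 2 ≠ ∞ := by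
    rw [ENNReal.tsum_prod (f := fun i j => ‖⟪b j, T i⟫_ℂ‖ₑ ^ 2)]
    simpa only [tsum_enorm_inner_sq] using hT
  simpa using ENNReal.summable_toReal h1

/-- Expanding each inner product in the basis gives a double series, absolutely summable by `xy ≤ x²
+ y²`, so the order of summation may be exchanged. -/
theorem tsum_inner_swap_basis (b : HilbertBasis ι ℂ K) {P Q : K →L[ℂ] K}
    (hP : ∑' i, ‖P (b i)‖ₑ ^ 2 ≠ ∞) (hQ : ∑' i, ‖Q (b i)‖ₑ ^ 2 ≠ ∞) :
    ∑' i, ⟪P (b i), Q (b i)⟫_ℂ = ∑' i, ⟪adjoint Q (b i), adjoint P (b i)⟫_ℂ := by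
  have hs : Summable fun p : ι × ι => ⟪P (b p.1), b p.2⟫_ℂ * ⟪b p.2, Q (b p.1)⟫_ℂ := by
    refine Summable.of_norm_bounded ((summable_inner_sq b hP).add (summable_inner_sq b hQ))
      fun p => ?_
    rw [norm_mul, ← inner_conj_symm, RCLike.norm_conj]
    generalize ‖⟪b p.2, P (b p.1)⟫_ℂ‖ = x
    generalize ‖⟪b p.2, Q (b p.1)⟫_ℂ‖ = y
    nlinarith [sq_nonneg (x - y), sq_nonneg (x + y)]
  calc ∑' i, ⟪P (b i), Q (b i)⟫_ℂ = ∑' i, ∑' j, ⟪P (b i), b j⟫_ℂ * ⟪b j, Q (b i)⟫_ℂ :=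
        tsum_congr fun i => (b.tsum_inner_mul_inner _ _).symm
    _ = ∑' j, ∑' i, ⟪P (b i), b j⟫_ℂ * ⟪b j, Q (b i)⟫_ℂ :=
        (Summable.tsum_comm (f := fun i j => ⟪P (b i), b j⟫_ℂ * ⟪b j, Q (b i)⟫_ℂ) hs).symm
    _ = ∑' j, ∑' i, ⟪adjoint Q (b j), b i⟫_ℂ * ⟪b i, adjoint P (b j)⟫_ℂ := by
        refine tsum_congr fun j => tsum_congr fun i => ?_
        rw [adjoint_inner_right, adjoint_inner_left, mul_comm]
    _ = _ := tsum_congr fun i => b.tsum_inner_mul_inner _ _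

/-- Cyclicity of the trace for products of two Hilbert-Schmidt operators. -/
theorem tsum_inner_swap {P Q : K →L[ℂ] K} (hP : hsSq P ≠ ∞) (hQ : hsSq Q ≠ ∞) :
    ∑' i, ⟪P (stdBasis K i), Q (stdBasis K i)⟫_ℂ =
      ∑' i, ⟪adjoint Q (stdBasis K i), adjoint P (stdBasis K i)⟫_ℂ :=
  tsum_inner_swap_basis (stdBasis K) hP hQ

end HilbertSchmidt

end WeakMean

namespace WeakMean

open ContinuousLinearMap

/-! ### Equality of `Tr BX` and `Tr X^{1/2} B X^{1/2}` for trace-class `BX`. -/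

section TraceIdentity

open Topology

variable {K : Type*} [NormedAddCommGroup K] [InnerProductSpace ℂ K] [CompleteSpace K]

/-- A form of the polar decomposition: `S x ↦ T x` is well defined and bounded because `‖T x‖`
depends only on `S x`. It extends to the closure of the range of `S`, and by zero to the orthogonal
complement. With `S = |T|^{1/2}` this is `W = U |T|^{1/2}`. -/
theorem exists_mul_eq_of_norm_eq {T S : K →L[ℂ] K} (hS : IsSelfAdjoint S)
    (h : ∀ x, ‖T x‖ = ‖S (S x)‖) : ∃ W : K →L[ℂ] K, W * S = T ∧ ∀ y, ‖W y‖ = ‖S y‖ := by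
  set V : Submodule ℂ K := (LinearMap.range S.toLinearMap).topologicalClosure with hV
  have hmem : ∀ x, S x ∈ V := fun x => Submodule.le_topologicalClosure _ ⟨x, rfl⟩
  have : CompleteSpace V := (Submodule.isClosed_topologicalClosure _).completeSpace_coe
  let e : K →ₗ[ℂ] V := S.toLinearMap.codRestrict V hmem
  have he : DenseRange e := by
    intro v
    have hv : (v : K) ∈ closure (Set.range S) := v.2
    rw [closure_subtype]
    convert hv using 2
    ext y
    simp only [Set.mem_image, Set.mem_range]
    constructor
    · rintro ⟨_, ⟨x, rfl⟩, rfl⟩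
      exact ⟨x, rfl⟩
    · rintro ⟨x, rfl⟩
      exact ⟨e x, ⟨x, rfl⟩, rfl⟩
  have hb : ∃ C, ∀ x, ‖T.toLinearMap x‖ ≤ C * ‖e x‖ :=
    ⟨‖S‖, fun x => by simpa [h, e] using S.le_opNorm (S x)⟩
  set W₀ : V →L[ℂ] K := T.toLinearMap.extendOfNorm e
  have hW₀ : ∀ x, W₀ (e x) = T x := fun x => LinearMap.extendOfNorm_eq he hb x
  have hn : ∀ v : V, ‖W₀ v‖ = ‖S v‖ := by
    intro v
    refine he.induction_on (p := fun v => ‖W₀ v‖ = ‖S v‖) v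
      (isClosed_eq (by fun_prop) (by fun_prop)) fun x => ?_
    rw [hW₀, h]
    rfl
  refine ⟨W₀ ∘L V.orthogonalProjectionOnto, ?_, fun y => ?_⟩
  · ext x
    have : V.orthogonalProjectionOnto (S x) = e x :=
      Submodule.orthogonalProjectionOnto_mem_subspace_eq_self (e x)
    rw [mul_apply_eq_comp, comp_apply, this, hW₀]
  · rw [comp_apply, hn]
    -- The orthogonal complement of the range of the self-adjoint `S` is its kernel.
    have hz : S (y - V.orthogonalProjectionOnto y) = 0 := by
      have h1 : y - V.orthogonalProjectionOnto y ∈ Vᗮ :=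
        Submodule.sub_starProjection_mem_orthogonal y
      refine ext_inner_left ℂ fun z => ?_
      rw [← adjoint_inner_left, ← star_eq_adjoint, hS.star_eq, inner_zero_right]
      exact h1 _ (hmem z)
    rw [map_sub, sub_eq_zero] at hz
    rw [hz]

theorem norm_abs_apply (T : K →L[ℂ] K) (x : K) : ‖CFC.abs T x‖ = ‖T x‖ := by
  have h : ∀ A : K →L[ℂ] K, ‖A x‖ ^ 2 = (⟪x, (star A * A) x⟫_ℂ).re := by
    intro A
    rw [mul_apply_eq_comp, star_eq_adjoint, adjoint_inner_right]
    exact (inner_self_eq_norm_sq (𝕜 := ℂ) _).symm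
  have hs : star (CFC.abs T) * CFC.abs T = star T * T := by
    rw [(IsSelfAdjoint.of_nonneg (CFC.abs_nonneg T)).star_eq, CFC.abs_mul_abs]
  have := h (CFC.abs T)
  rw [hs, ← h T] at this
  exact (sq_eq_sq₀ (norm_nonneg _) (norm_nonneg _)).1 this

/-- A trace-class operator is the product of two Hilbert-Schmidt operators. -/
theorem IsTraceClass.exists_factor {T : K →L[ℂ] K} (hT : IsTraceClass T) :
    ∃ W S : K →L[ℂ] K, W * S = T ∧ IsSelfAdjoint S ∧ (∀ x, ‖S (S x)‖ = ‖T x‖) ∧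
      hsSq S ≠ ∞ ∧ hsSq W ≠ ∞ := by
  have hs : CFC.sqrt (CFC.abs T) * CFC.sqrt (CFC.abs T) = CFC.abs T :=
    CFC.sqrt_mul_sqrt_self _ (CFC.abs_nonneg T)
  have hn : ∀ x, ‖CFC.sqrt (CFC.abs T) (CFC.sqrt (CFC.abs T) x)‖ = ‖T x‖ := by
    intro x
    rw [← norm_abs_apply T, ← mul_apply_eq_comp, hs]
  have hfin : hsSq (CFC.sqrt (CFC.abs T)) ≠ ∞ := by
    rw [← psdTrace_eq_hsSq_sqrt (CFC.abs_nonneg T)]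
    exact ne_of_lt hT
  obtain ⟨W, hW, hWn⟩ := exists_mul_eq_of_norm_eq (T := T) (isSelfAdjoint_sqrt (CFC.abs T))
    fun x => (hn x).symm
  refine ⟨W, _, hW, isSelfAdjoint_sqrt _, hn, hfin, ?_⟩
  have hWe : ∀ y, ‖W y‖ₑ = ‖CFC.sqrt (CFC.abs T) y‖ₑ := fun y => by
    rw [← ofReal_norm, hWn, ofReal_norm]
  simp only [hsSq, hWe]
  exact hfin

/-- Resolvent-type approximation of the support projection of a positive operator `X`:
`X k² = 1 - r` with `k` and `r` self-adjoint, commuting with `X`. -/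
theorem exists_support_approx {X : K →L[ℂ] K} (hX : 0 ≤ X) {ε : ℝ} (hε : 0 < ε) :
    ∃ k r : K →L[ℂ] K, IsSelfAdjoint k ∧ k * X = X * k ∧ k * (k * X) = 1 - r ∧
      ‖r‖ ≤ 1 ∧ ‖1 - r‖ ≤ 1 ∧ ‖X * r‖ ≤ ε ∧ 0 ≤ X * r := by
  have hsa : IsSelfAdjoint X := .of_nonneg hX
  have hsp : ∀ x ∈ spectrum ℝ X, 0 ≤ x := fun x hx => spectrum_nonneg_of_nonneg hX hx
  -- Here `k = (X + ε)^{-1/2}` and `r = ε (X + ε)^{-1}`; the absolute value only serves to make `f`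
  -- continuous on all of `ℝ`.
  let f : ℝ → ℝ := fun x => (√(|x| + ε))⁻¹
  have hf : Continuous f := by
    refine Continuous.inv₀ (by fun_prop) fun x => ?_
    have : 0 < |x| + ε := by positivity
    positivity
  have hff : ∀ x, 0 ≤ x → f x * (f x * x) = x / (x + ε) := by
    intro x hx
    have h1 : 0 < x + ε := by positivity
    simp only [f, abs_of_nonneg hx]
    rw [← mul_assoc, ← mul_inv, Real.mul_self_sqrt h1.le]
    field_simp
  let g : ℝ → ℝ := fun x => 1 - f x * (f x * x)
  have hg : Continuous g := by fun_prop
  have hgx : ∀ x, 0 ≤ x → g x = ε / (x + ε) := by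
    intro x hx
    have h1 : 0 < x + ε := by positivity
    simp only [g, hff x hx]
    field_simp
    ring
  have hkX : cfc f X * X = cfc (fun x => f x * x) X := by
    conv_lhs => rw [← cfc_id ℝ X]
    rw [cfc_id ℝ X]
    conv_lhs => enter [2]; rw [← cfc_id ℝ X]
    exact (cfc_mul f id X (hf.continuousOn) (by fun_prop)).symm
  have hXk : X * cfc f X = cfc (fun x => f x * x) X := by
    rw [← hkX]
    exact (cfc_commute_cfc id f X |>.eq |> fun h => by rwa [cfc_id ℝ X] at h)
  have hr : cfc f X * (cfc f X * X) = 1 - cfc g X := by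
    rw [hkX, ← cfc_mul f (fun x => f x * x) X hf.continuousOn (by fun_prop)]
    have : cfc g X = 1 - cfc (fun x => f x * (f x * x)) X := by
      rw [← cfc_one ℝ X, ← cfc_sub _ _ X (by fun_prop) (by fun_prop)]
      rfl
    rw [this, sub_sub_cancel]
  have hXr : X * cfc g X = cfc (fun x => x * g x) X := by
    conv_lhs => enter [1]; rw [← cfc_id ℝ X]
    exact (cfc_mul id g X (by fun_prop) hg.continuousOn).symm
  refine ⟨cfc f X, cfc g X, cfc_predicate f X, by rw [hkX, hXk], hr, ?_, ?_, ?_, ?_⟩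
  · refine norm_cfc_le zero_le_one fun x hx => ?_
    have h0 := hsp x hx
    rw [hgx x h0, Real.norm_of_nonneg (by positivity), div_le_one (by positivity)]
    linarith
  · rw [← hr, hkX, ← cfc_mul f (fun x => f x * x) X hf.continuousOn (by fun_prop)]
    refine norm_cfc_le zero_le_one fun x hx => ?_
    have h0 := hsp x hx
    rw [hff x h0, Real.norm_of_nonneg (by positivity), div_le_one (by positivity)]
    linarith
  · rw [hXr]
    refine norm_cfc_le hε.le fun x hx => ?_
    have h0 := hsp x hx
    rw [hgx x h0, Real.norm_of_nonneg (by positivity), mul_div_assoc', div_le_iff₀ (by positivity)]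
    nlinarith [sq_nonneg ε]
  · rw [hXr]
    refine cfc_nonneg fun x hx => ?_
    have h0 := hsp x hx
    rw [hgx x h0]
    positivity

theorem toReal_hsSq (P : K →L[ℂ] K) : (hsSq P).toReal = ∑' i, ‖P (stdBasis K i)‖ ^ 2 := by
  rw [hsSq, ENNReal.tsum_toReal_eq (by simp)]
  simp

theorem hsSq_mul_ne_top {P : K →L[ℂ] K} (Q : K →L[ℂ] K) (hP : hsSq P ≠ ∞) : hsSq (P * Q) ≠ ∞ := by
  rw [← hsSq_star, star_mul]
  refine ne_top_of_le_ne_top ?_ (hsSq_mul_le _ _)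
  rw [hsSq_star]
  exact ENNReal.mul_ne_top (by simp) hP

theorem mul_hsSq_ne_top (P : K →L[ℂ] K) {Q : K →L[ℂ] K} (hQ : hsSq Q ≠ ∞) : hsSq (P * Q) ≠ ∞ :=
  ne_top_of_le_ne_top (ENNReal.mul_ne_top (by simp) hQ) (hsSq_mul_le _ _)

theorem summable_norm_mul_norm {P Q : K →L[ℂ] K} (hP : hsSq P ≠ ∞) (hQ : hsSq Q ≠ ∞) :
    Summable fun i => ‖P (stdBasis K i)‖ * ‖Q (stdBasis K i)‖ := by
  refine Summable.of_nonneg_of_le (fun i => by positivity) (fun i => ?_)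
    ((summable_of_hsSq hP).add (summable_of_hsSq hQ))
  nlinarith [sq_nonneg (‖P (stdBasis K i)‖ - ‖Q (stdBasis K i)‖),
    sq_nonneg (‖P (stdBasis K i)‖ + ‖Q (stdBasis K i)‖)]

theorem tr_mul_eq {P Q : K →L[ℂ] K} (hP : hsSq P ≠ ∞) (hQ : hsSq Q ≠ ∞) :
    tr (P * Q) = ∑' i, ⟪star Q (stdBasis K i), P (stdBasis K i)⟫_ℂ := by
  rw [← hsSq_star] at hP
  have := tsum_inner_swap hP hQ
  rw [← star_eq_adjoint, ← star_eq_adjoint, star_star] at this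
  rw [← this, tr]
  refine tsum_congr fun i => ?_
  rw [mul_apply_eq_comp, star_eq_adjoint, adjoint_inner_left]

theorem norm_sq_eq_re_inner (A : K →L[ℂ] K) (x : K) : ‖A x‖ ^ 2 = (⟪x, (star A * A) x⟫_ℂ).re := by
  rw [mul_apply_eq_comp, star_eq_adjoint, adjoint_inner_right]
  exact (inner_self_eq_norm_sq (𝕜 := ℂ) _).symm

theorem tsum_re_inner_swap {P Q : K →L[ℂ] K} (hP : hsSq P ≠ ∞) (hQ : hsSq Q ≠ ∞) :
    ∑' i, (⟪P (stdBasis K i), Q (stdBasis K i)⟫_ℂ).re =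
      ∑' i, (⟪star Q (stdBasis K i), star P (stdBasis K i)⟫_ℂ).re := by
  have hs : ∀ {P Q : K →L[ℂ] K}, hsSq P ≠ ∞ → hsSq Q ≠ ∞ →
      Summable fun i => ⟪P (stdBasis K i), Q (stdBasis K i)⟫_ℂ := fun hP hQ =>
    Summable.of_norm_bounded (summable_norm_mul_norm hP hQ) fun i => norm_inner_le_norm _ _
  rw [← Complex.re_tsum (hs hP hQ), tsum_inner_swap hP hQ]
  exact Complex.re_tsum (hs (by rwa [hsSq_adjoint]) (by rwa [hsSq_adjoint]))

theorem hsSq_ne_top_of_summable {P : K →L[ℂ] K}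
    (h : Summable fun i => ‖P (stdBasis K i)‖ ^ 2) : hsSq P ≠ ∞ := by
  have h3 := ENNReal.ofReal_tsum_of_nonneg (fun i => sq_nonneg _) h
  simp only [ENNReal.ofReal_pow (norm_nonneg _), ofReal_norm] at h3
  rw [hsSq, ← h3]
  exact ENNReal.ofReal_ne_top

/-- The cut-off `k` makes cyclicity available: with `BX = WS`, the form `k X B X k` factors through
the Hilbert-Schmidt operators `W* X k` and `S k`. Swapping them brings the two copies of `k` next to
`X`, where they combine to `1 - r`. -/
theorem summable_and_tsum_norm_sq_swap {B X W S k r : K →L[ℂ] K} (hB : 0 ≤ B) (hX : 0 ≤ X)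
    (hWS : W * S = B * X) (hSa : IsSelfAdjoint S) (hS : hsSq S ≠ ∞) (hW : hsSq W ≠ ∞)
    (hk : IsSelfAdjoint k) (hr : k * (k * X) = 1 - r) :
    Summable (fun i => ‖(k * X * CFC.sqrt B) (stdBasis K i)‖ ^ 2) ∧
    ∑' i, ‖(k * X * CFC.sqrt B) (stdBasis K i)‖ ^ 2 =
      ∑' i, (⟪S (stdBasis K i), (1 - r) (W (stdBasis K i))⟫_ℂ).re := by
  have hXs : star X = X := (IsSelfAdjoint.of_nonneg hX).star_eq
  have hBB : CFC.sqrt B * CFC.sqrt B = B := CFC.sqrt_mul_sqrt_self B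
  have hP : hsSq (star W * (X * k)) ≠ ∞ := hsSq_mul_ne_top _ (by rwa [hsSq_star])
  have hQ : hsSq (S * k) ≠ ∞ := hsSq_mul_ne_top _ hS
  have h1 := tsum_re_inner_swap hP hQ
  have h2 : star (k * X * CFC.sqrt B) = CFC.sqrt B * (X * k) := by
    rw [star_mul, star_mul, isSelfAdjoint_sqrt, hXs, hk.star_eq]
  have h3 : star (S * k) = k * S := by rw [star_mul, hSa.star_eq, hk.star_eq]
  have h4 : star (star W * (X * k)) = k * X * W := by
    rw [star_mul, star_mul, star_star, hXs, hk.star_eq]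
  rw [h3, h4] at h1
  have hpt : ∀ i, ‖(CFC.sqrt B * (X * k)) (stdBasis K i)‖ ^ 2 =
      (⟪(star W * (X * k)) (stdBasis K i), (S * k) (stdBasis K i)⟫_ℂ).re := by
    intro i
    rw [norm_sq_eq_re_inner, star_mul, isSelfAdjoint_sqrt]
    have : star (X * k) * CFC.sqrt B * (CFC.sqrt B * (X * k)) =
        star (X * k) * (W * (S * k)) := by
      rw [mul_assoc, ← mul_assoc (CFC.sqrt B), hBB, ← mul_assoc B, ← hWS, mul_assoc W]
    rw [this, mul_apply_eq_comp, mul_apply_eq_comp, star_eq_adjoint, adjoint_inner_right,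
      mul_apply_eq_comp (star W), star_eq_adjoint, adjoint_inner_left]
  have hfin : hsSq (k * X * CFC.sqrt B) ≠ ∞ := by
    rw [← hsSq_star, h2]
    refine hsSq_ne_top_of_summable ?_
    simp only [hpt]
    refine Summable.of_norm_bounded (summable_norm_mul_norm hP hQ) fun i => ?_
    exact (Complex.abs_re_le_norm _).trans (norm_inner_le_norm _ _)
  refine ⟨summable_of_hsSq hfin, ?_⟩
  rw [← toReal_hsSq, ← hsSq_star, toReal_hsSq, h2]
  calc _ = ∑' i, (⟪(star W * (X * k)) (stdBasis K i), (S * k) (stdBasis K i)⟫_ℂ).re :=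
        tsum_congr hpt
    _ = _ := h1
    _ = _ := by
        refine tsum_congr fun i => ?_
        have : (1 - r) (W (stdBasis K i)) = k ((k * X * W) (stdBasis K i)) := by
          rw [← hr]; rfl
        have hks : adjoint k = k := hk.star_eq
        rw [this, mul_apply_eq_comp k S, ← adjoint_inner_right, hks]

theorem norm_mul_sq_le_of_norm_sq {S T r : K →L[ℂ] K} (hSa : IsSelfAdjoint S)
    (hSS : ∀ x, ‖S (S x)‖ = ‖T x‖) (x : K) : ‖S (r x)‖ ^ 2 ≤ ‖r x‖ * ‖T (r x)‖ := by
  rw [norm_sq_eq_re_inner, hSa.star_eq, mul_apply_eq_comp, ← hSS]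
  exact (Complex.re_le_norm _).trans (norm_inner_le_norm _ _)

/-- If `B X` is trace-class then `Tr X^{1/2} B X^{1/2}` is finite and equals `Tr B X`. -/
theorem IsTraceClass.summable_and_tsum_eq {B X : K →L[ℂ] K} (hB : 0 ≤ B) (hX : 0 ≤ X)
    (h : IsTraceClass (B * X)) :
    Summable (fun i => ‖(CFC.sqrt X * CFC.sqrt B) (stdBasis K i)‖ ^ 2) ∧
      ∑' i, ‖(CFC.sqrt X * CFC.sqrt B) (stdBasis K i)‖ ^ 2 = (tr (B * X)).re := by
  obtain ⟨W, S, hWS, hSa, hSS, hS, hW⟩ := h.exists_factor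
  have hε : ∀ n : ℕ, (0 : ℝ) < 1 / ((n : ℝ) + 1) := fun n => by positivity
  have hlim : Tendsto (fun n : ℕ => (1 : ℝ) / ((n : ℝ) + 1)) atTop (𝓝 0) :=
    tendsto_one_div_add_atTop_nhds_zero_nat
  choose k r hk hkX hkkX hr hr1 hXr hXr0 using fun n => exists_support_approx hX (hε n)
  have hXs : star X = X := (IsSelfAdjoint.of_nonneg hX).star_eq
  have hXX : CFC.sqrt X * CFC.sqrt X = X := CFC.sqrt_mul_sqrt_self X
  have hsum := summable_norm_mul_norm hS hW
  have hswap := fun n => summable_and_tsum_norm_sq_swap hB hX hWS hSa hS hW (hk n) (hkkX n)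
  have hsn := fun n => (hswap n).1
  replace hswap := fun n => (hswap n).2
  have htr : (tr (B * X)).re = ∑' i, (⟪S (stdBasis K i), W (stdBasis K i)⟫_ℂ).re := by
    rw [← hWS, tr_mul_eq hW hS, hSa.star_eq, Complex.re_tsum]
    exact Summable.of_norm_bounded hsum fun i => norm_inner_le_norm _ _
  rw [htr]
  generalize hE : (fun i => stdBasis K i) = e at *
  have hE' : ∀ i, stdBasis K i = e i := fun i => congrFun hE i
  simp only [hE'] at *
  clear htr hE hE'
  -- The cut-off error is the quadratic form of `X r n`, which is non-negative and of size at most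
  -- `1 / (n + 1)`. So the regularised terms converge from below.
  have hsub : ∀ n i, ‖(CFC.sqrt X * CFC.sqrt B) (e i)‖ ^ 2 - ‖(k n * X * CFC.sqrt B) (e i)‖ ^ 2 =
      (⟪CFC.sqrt B (e i), (X * r n) (CFC.sqrt B (e i))⟫_ℂ).re := by
    intro n i
    rw [mul_apply_eq_comp, norm_sq_eq_re_inner, isSelfAdjoint_sqrt, hXX, mul_apply_eq_comp _ (CFC.sqrt B),
      norm_sq_eq_re_inner, star_mul, hXs, (hk n).star_eq, mul_assoc, hkkX, mul_sub, mul_one,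
      sub_apply, inner_sub_right, Complex.sub_re, sub_sub_cancel]
  have hle : ∀ n i, ‖(k n * X * CFC.sqrt B) (e i)‖ ^ 2 ≤ ‖(CFC.sqrt X * CFC.sqrt B) (e i)‖ ^ 2 := by
    intro n i
    have := re_inner_nonneg (hXr0 n) (CFC.sqrt B (e i))
    rw [← hsub] at this
    linarith
  have hlim1 : ∀ i, Tendsto (fun n => ‖(k n * X * CFC.sqrt B) (e i)‖ ^ 2) atTop
      (𝓝 (‖(CFC.sqrt X * CFC.sqrt B) (e i)‖ ^ 2)) := by
    intro i
    have h0 : Tendsto (fun n => ‖(CFC.sqrt X * CFC.sqrt B) (e i)‖ ^ 2 -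
        ‖(k n * X * CFC.sqrt B) (e i)‖ ^ 2) atTop (𝓝 0) := by
      refine squeeze_zero (fun n => sub_nonneg.2 (hle n i))
        (g := fun n : ℕ => ‖CFC.sqrt B (e i)‖ * (1 / ((n : ℝ) + 1) * ‖CFC.sqrt B (e i)‖))
        (fun n => ?_) ?_
      · rw [hsub]
        refine (Complex.re_le_norm _).trans ((norm_inner_le_norm _ _).trans ?_)
        gcongr
        exact (le_opNorm _ _).trans (by gcongr; exact hXr n)
      · simpa using (hlim.mul_const ‖CFC.sqrt B (e i)‖).const_mul ‖CFC.sqrt B (e i)‖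
    have h1 := h0.const_sub (‖(CFC.sqrt X * CFC.sqrt B) (e i)‖ ^ 2)
    rw [sub_zero] at h1
    exact h1.congr fun n => by ring
  have hbd : ∀ n i, ‖(⟪S (e i), (1 - r n) (W (e i))⟫_ℂ).re‖ ≤ ‖S (e i)‖ * ‖W (e i)‖ := by
    intro n i
    refine (Complex.abs_re_le_norm _).trans ((norm_inner_le_norm _ _).trans ?_)
    gcongr
    exact (le_opNorm _ _).trans (mul_le_of_le_one_left (norm_nonneg _) (hr1 n))
  -- `1 - r n` approximates only the support projection of `X`, but this suffices: `S²` has the same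
  -- norms as `BX`, and `B X r n` tends to zero in norm.
  have hlimS : ∀ x, Tendsto (fun n => S (r n x)) atTop (𝓝 0) := by
    intro x
    rw [tendsto_zero_iff_norm_tendsto_zero]
    have : Tendsto (fun n => √(‖S (r n x)‖ ^ 2)) atTop (𝓝 0) := by
      rw [← Real.sqrt_zero]
      refine (Real.continuous_sqrt.tendsto 0).comp ?_
      refine squeeze_zero (fun n => by positivity)
        (g := fun n : ℕ => ‖x‖ * (‖B‖ * (1 / ((n : ℝ) + 1) * ‖x‖))) (fun n => ?_) ?_
      · refine (norm_mul_sq_le_of_norm_sq hSa hSS x).trans ?_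
        gcongr
        · exact (le_opNorm _ _).trans (mul_le_of_le_one_left (norm_nonneg _) (hr n))
        · rw [mul_apply_eq_comp]
          refine (le_opNorm _ _).trans ?_
          gcongr
          rw [← mul_apply_eq_comp]
          exact (le_opNorm _ _).trans (by gcongr; exact hXr n)
      · simpa using ((hlim.mul_const ‖x‖).const_mul ‖B‖).const_mul ‖x‖
    simpa using this
  have hlim2 : ∀ i, Tendsto (fun n => (⟪S (e i), (1 - r n) (W (e i))⟫_ℂ).re) atTop
      (𝓝 (⟪S (e i), W (e i)⟫_ℂ).re) := by
    intro i
    have hrw : ∀ n, ⟪S (e i), (1 - r n) (W (e i))⟫_ℂ =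
        ⟪S (e i), W (e i)⟫_ℂ - ⟪e i, S (r n (W (e i)))⟫_ℂ := by
      intro n
      have hSs : adjoint S = S := hSa.star_eq
      rw [sub_apply, one_apply_eq_self, inner_sub_right, ← adjoint_inner_left S, hSs]
    simp only [hrw]
    have := (tendsto_const_nhds (x := e i)).inner (𝕜 := ℂ) (hlimS (W (e i)))
    rw [inner_zero_right] at this
    have h1 := (Complex.continuous_re.tendsto _).comp (this.const_sub ⟪S (e i), W (e i)⟫_ℂ)
    rwa [sub_zero] at h1
  have hT2 := tendsto_tsum_of_dominated_convergence hsum hlim2 (Eventually.of_forall hbd)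
  -- Fatou's argument: finite partial sums are limits of regularised ones, all bounded by the
  -- majorant `∑ ‖S e i‖ ‖W e i‖`.
  have hsa : Summable fun i => ‖(CFC.sqrt X * CFC.sqrt B) (e i)‖ ^ 2 := by
    refine summable_of_sum_le (c := ∑' i, ‖S (e i)‖ * ‖W (e i)‖) (fun i => by positivity)
      fun F => ?_
    refine le_of_tendsto (tendsto_finsetSum F fun i _ => hlim1 i) (Eventually.of_forall fun n => ?_)
    refine ((hsn n).sum_le_tsum F fun i _ => by positivity).trans ?_
    rw [hswap]
    refine Summable.tsum_le_tsum (fun i => (le_abs_self _).trans (hbd n i)) ?_ hsum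
    exact Summable.of_norm_bounded hsum (hbd n)
  refine ⟨hsa, ?_⟩
  have hT1 := tendsto_tsum_of_dominated_convergence hsa hlim1
    (Eventually.of_forall fun n i => by
      rw [Real.norm_of_nonneg (by positivity)]
      exact hle n i)
  simp only [hswap] at hT1
  exact tendsto_nhds_unique hT1 hT2

theorem IsTraceClass.sandwichTrace_eq {B X : K →L[ℂ] K} (hB : 0 ≤ B) (hX : 0 ≤ X)
    (h : IsTraceClass (B * X)) :
    0 ≤ (tr (B * X)).re ∧ sandwichTrace B X = ENNReal.ofReal (tr (B * X)).re := by
  obtain ⟨h1, h2⟩ := h.summable_and_tsum_eq hB hX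
  rw [← h2]
  refine ⟨tsum_nonneg fun i => by positivity, ?_⟩
  rw [sandwichTrace_comm hB hX, sandwichTrace_eq_hsSq hX, ← toReal_hsSq,
    ENNReal.ofReal_toReal (hsSq_ne_top_of_summable h1)]

/-- No cut-off is needed here: `√ρ` is itself Hilbert-Schmidt, so cyclicity applies to `√ρ` and `√ρ
Z`. -/
theorem tr_density_mul {ρ Z : K →L[ℂ] K} (hρ : 0 ≤ ρ) (hρt : psdTrace ρ ≠ ∞) (hZ : 0 ≤ Z) :
    (tr (ρ * Z)).re = (sandwichTrace Z ρ).toReal := by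
  have hP : hsSq (CFC.sqrt ρ) ≠ ∞ := by rwa [← psdTrace_eq_hsSq_sqrt hρ]
  have hρρ : CFC.sqrt ρ * CFC.sqrt ρ = ρ := CFC.sqrt_mul_sqrt_self ρ
  have hQ : hsSq (CFC.sqrt ρ * Z) ≠ ∞ := hsSq_mul_ne_top _ hP
  have h1 := tr_mul_eq hP hQ
  rw [← mul_assoc, hρρ] at h1
  have hZs : star Z = Z := (IsSelfAdjoint.of_nonneg hZ).star_eq
  rw [h1, star_mul, isSelfAdjoint_sqrt, hZs, Complex.re_tsum, sandwichTrace_eq_hsSq hZ, toReal_hsSq]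
  · refine tsum_congr fun i => ?_
    rw [mul_apply_eq_comp, mul_apply_eq_comp, norm_sq_eq_re_inner, isSelfAdjoint_sqrt,
      CFC.sqrt_mul_sqrt_self Z, ← adjoint_inner_right Z, ← star_eq_adjoint, hZs]
  · exact Summable.of_norm_bounded (summable_norm_mul_norm (mul_hsSq_ne_top Z hP) hP)
      fun i => norm_inner_le_norm _ _

theorem sandwichTrace_ne_top {Z ρ : K →L[ℂ] K} (hρ : 0 ≤ ρ) (hρt : psdTrace ρ ≠ ∞)
    (hZ : 0 ≤ Z) : sandwichTrace Z ρ ≠ ∞ := by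
  rw [sandwichTrace_eq_hsSq hZ]
  exact mul_hsSq_ne_top _ (by rwa [← psdTrace_eq_hsSq_sqrt hρ])

end TraceIdentity

end WeakMean

namespace WeakMean

open ContinuousLinearMap

/-! ### Extending operators to completions and to tensor products. -/

section Completion

variable {E F : Type*} [NormedAddCommGroup E] [InnerProductSpace ℂ E]
  [NormedAddCommGroup F] [InnerProductSpace ℂ F]

theorem completion_ext {f g : Completion E →L[ℂ] F} (h : ∀ x : E, f x = g x) : f = g := by
  ext x
  induction x using Completion.induction_on with
  | hp => exact isClosed_eq f.continuous g.continuous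
  | ih x => exact h x

theorem norm_completion_le (f : E →L[ℂ] E) : ‖f.completion‖ ≤ ‖f‖ := by
  refine opNorm_le_bound _ (norm_nonneg _) fun x => ?_
  induction x using Completion.induction_on with
  | hp => exact isClosed_le (by fun_prop) (by fun_prop)
  | ih x =>
    rw [completion_apply_coe, Completion.norm_coe, Completion.norm_coe]
    exact f.le_opNorm x

theorem continuous_completion :
    Continuous (ContinuousLinearMap.completion : (E →L[ℂ] E) → _) := by
  have hsub : ∀ f g : E →L[ℂ] E, f.completion - g.completion = (f - g).completion := fun f g =>
    completion_ext fun x => by simp [← Completion.coe_sub]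
  refine (LipschitzWith.of_dist_le_mul (K := 1) fun f g => ?_).continuous
  rw [dist_eq_norm, dist_eq_norm, hsub, NNReal.coe_one, one_mul]
  exact norm_completion_le _

theorem star_completion {f g : E →L[ℂ] E} (h : ∀ x y, ⟪f x, y⟫_ℂ = ⟪x, g y⟫_ℂ) :
    star f.completion = g.completion := by
  symm
  rw [star_eq_adjoint, eq_adjoint_iff]
  intro x y
  induction x, y using Completion.induction_on₂ with
  | hp => exact isClosed_eq (by fun_prop) (by fun_prop)
  | ih x y =>
    rw [completion_apply_coe, completion_apply_coe, Completion.inner_coe, Completion.inner_coe,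
      ← inner_conj_symm, ← h, inner_conj_symm]

theorem inner_mapL {S S' : E →L[ℂ] E} {T T' : F →L[ℂ] F} (hS : ∀ x y, ⟪S x, y⟫_ℂ = ⟪x, S' y⟫_ℂ)
    (hT : ∀ x y, ⟪T x, y⟫_ℂ = ⟪x, T' y⟫_ℂ) (x y : E ⊗[ℂ] F) :
    ⟪TensorProduct.mapL S T x, y⟫_ℂ = ⟪x, TensorProduct.mapL S' T' y⟫_ℂ := by
  induction x using TensorProduct.induction_on with
  | zero => simp only [map_zero, inner_zero_left]
  | add x₁ x₂ h₁ h₂ => rw [map_add, inner_add_left, inner_add_left, h₁, h₂]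
  | tmul a b =>
    induction y using TensorProduct.induction_on with
    | zero => simp only [map_zero, inner_zero_right]
    | add y₁ y₂ h₁ h₂ => rw [map_add, inner_add_right, inner_add_right, h₁, h₂]
    | tmul c d =>
      rw [TensorProduct.mapL_tmul, TensorProduct.mapL_tmul, TensorProduct.inner_tmul,
        TensorProduct.inner_tmul, hS, hT]

/-- `S ⊗ T` factors as `(S ⊗ 1)(1 ⊗ T)`, and each factor depends on its operator in a linear and
contractive way. -/
theorem continuous_mapL {Y : Type*} [TopologicalSpace Y] {f : Y → E →L[ℂ] E} {g : Y → F →L[ℂ] F}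
    (hf : Continuous f) (hg : Continuous g) :
    Continuous fun y => TensorProduct.mapL (f y) (g y) := by
  have h1 : Continuous fun f : E →L[ℂ] E => f.rTensor F := by
    have h : LipschitzWith 1 fun f : E →L[ℂ] E => f.rTensor F := by
      refine LipschitzWith.of_dist_le_mul fun f g => ?_
      rw [dist_eq_norm, dist_eq_norm, ← rTensor_sub, NNReal.coe_one, one_mul]
      exact norm_rTensor_le F (f - g)
    exact h.continuous
  have h2 : Continuous fun g : F →L[ℂ] F => g.lTensor E := by
    have h : LipschitzWith 1 fun f : F →L[ℂ] F => f.lTensor E := by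
      refine LipschitzWith.of_dist_le_mul fun f g => ?_
      rw [dist_eq_norm, dist_eq_norm, ← lTensor_sub, NNReal.coe_one, one_mul]
      exact norm_lTensor_le E (f - g)
    exact h.continuous
  exact (h1.comp hf).clm_comp (h2.comp hg)

end Completion

/-! ### Tensor powers of operators. -/

section Pow

variable {H : Type u} [NormedAddCommGroup H] [InnerProductSpace ℂ H]

theorem algOpPow_succ_apply (A : H →L[ℂ] H) (n : ℕ) (x : AlgPow H n ⊗[ℂ] H) :
    algOpPow A (n + 1) ((algSucc H n).symm x) =
      (algSucc H n).symm (TensorProduct.mapL (algOpPow A n) A x) := rfl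

theorem algOpPow_mul_apply (A B : H →L[ℂ] H) (n : ℕ) (x : AlgPow H n) :
    algOpPow (A * B) n x = algOpPow A n (algOpPow B n x) := by
  induction n with
  | zero => rfl
  | succ n ih =>
    obtain ⟨x, rfl⟩ := (algSucc H n).symm.surjective x
    rw [algOpPow_succ_apply, algOpPow_succ_apply, algOpPow_succ_apply]
    have : algOpPow (A * B) n = algOpPow A n ∘L algOpPow B n := by
      ext x
      exact ih x
    rw [this]
    congr 1
    exact congrArg (fun f : AlgPow H n ⊗[ℂ] H →L[ℂ] AlgPow H n ⊗[ℂ] H => f x)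
      (TensorProduct.mapL_comp (algOpPow A n) (algOpPow B n) A B)

theorem opPow_mul (A B : H →L[ℂ] H) (n : ℕ) : opPow (A * B) n = opPow A n * opPow B n :=
  completion_ext fun x => by
    rw [mul_apply_eq_comp, opPow, opPow, opPow, completion_apply_coe, completion_apply_coe,
      completion_apply_coe, algOpPow_mul_apply]

theorem continuous_opPow {Y : Type*} [TopologicalSpace Y] {A : Y → H →L[ℂ] H} (hA : Continuous A)
    (n : ℕ) : Continuous fun y => opPow (A y) n := by
  refine continuous_completion.comp ?_
  induction n with
  | zero => exact continuous_const
  | succ n ih => exact continuous_const.clm_comp ((continuous_mapL ih hA).clm_comp continuous_const)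

variable [CompleteSpace H]

theorem opPow_star (A : H →L[ℂ] H) (n : ℕ) : opPow (star A) n = star (opPow A n) := by
  refine (star_completion ?_).symm
  induction n with
  | zero => exact fun x y => rfl
  | succ n ih =>
    intro x y
    obtain ⟨x, rfl⟩ := (algSucc H n).symm.surjective x
    obtain ⟨y, rfl⟩ := (algSucc H n).symm.surjective y
    rw [algOpPow_succ_apply, algOpPow_succ_apply, LinearIsometryEquiv.inner_map_map,
      LinearIsometryEquiv.inner_map_map]
    exact inner_mapL ih (fun x y => by rw [star_eq_adjoint, adjoint_inner_right]) x y

/-- Compatibility with products and adjoints exhibits the power of `A` as `Q* Q` with `Q` the power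
of `√A`. -/
theorem opPow_nonneg {A : H →L[ℂ] H} (hA : 0 ≤ A) (n : ℕ) : 0 ≤ opPow A n := by
  rw [← CFC.sqrt_mul_sqrt_self A hA, opPow_mul]
  conv_rhs => enter [1]; rw [← isSelfAdjoint_sqrt, opPow_star]
  exact star_mul_self_nonneg _

end Pow

/-! ### Juxtaposition of tensor powers and multiplicativity of the trace. -/

section Append

variable {H : Type u} [NormedAddCommGroup H] [InnerProductSpace ℂ H] {n m : ℕ}

/-- The elementary tensor `x ⊗ y ∈ H^{⊗ (n+m)}` of `x ∈ H^{⊗ n}` and `y ∈ H^{⊗ m}`. -/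
noncomputable def powTmul (x : HilbertPow H n) (y : HilbertPow H m) : HilbertPow H (n + m) :=
  append H n m ((x ⊗ₜ[ℂ] y : HilbertPow H n ⊗[ℂ] HilbertPow H m) :
    HTensor (HilbertPow H n) (HilbertPow H m))

theorem inner_powTmul (x x' : HilbertPow H n) (y y' : HilbertPow H m) :
    ⟪powTmul x y, powTmul x' y'⟫_ℂ = ⟪x, x'⟫_ℂ * ⟪y, y'⟫_ℂ := by
  rw [powTmul, powTmul, LinearIsometryEquiv.inner_map_map, Completion.inner_coe,
    TensorProduct.inner_tmul]

theorem enorm_powTmul (x : HilbertPow H n) (y : HilbertPow H m) :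
    ‖powTmul x y‖ₑ = ‖x‖ₑ * ‖y‖ₑ := by
  rw [powTmul, LinearIsometryEquiv.enorm_map, Completion.enorm_coe, TensorProduct.enorm_tmul]

theorem powTensor_powTmul (S : HilbertPow H n →L[ℂ] HilbertPow H n)
    (T : HilbertPow H m →L[ℂ] HilbertPow H m) (x : HilbertPow H n) (y : HilbertPow H m) :
    powTensor S T (powTmul x y) = powTmul (S x) (T y) := by
  change append H n m (opTensor S T ((append H n m).symm (append H n m _))) = _
  rw [LinearIsometryEquiv.symm_apply_apply, opTensor, completion_apply_coe,
    TensorProduct.mapL_tmul]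
  rfl

theorem continuous_powTmul : Continuous fun p : HilbertPow H n × HilbertPow H m =>
    powTmul p.1 p.2 :=
  (append H n m).continuous.comp
    ((Completion.continuous_coe _).comp (TensorProduct.continuous_tmul (𝕜 := ℂ)))

theorem powTmul_coe (x : AlgPow H n) (y : AlgPow H m) :
    powTmul (x : HilbertPow H n) (y : HilbertPow H m) =
      ((algAppend H n m (x ⊗ₜ y) : AlgPow H (n + m)) : HilbertPow H (n + m)) := by
  have h := LinearEquiv.extendOfIsometry_eq (f := (algAppend H n m).toLinearEquiv)
    (e₁ := (toHTensor (AlgPow H n) (AlgPow H m)).toLinearMap)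
    (e₂ := (Completion.toComplₗᵢ (𝕜 := ℂ) (E := AlgPow H (n + m))).toLinearMap)
    (denseRange_toHTensor _ _) Completion.denseRange_coe (by intro x; simp) (x ⊗ₜ y)
  exact h

theorem algAppend_succ_tmul (x : AlgPow H n) (y : AlgPow H m) (h : H) :
    algAppend H n (m + 1) (x ⊗ₜ ((algSucc H m).symm (y ⊗ₜ h))) =
      (algSucc H (n + m)).symm (algAppend H n m (x ⊗ₜ y) ⊗ₜ h) := rfl

/-- Induction on the right-hand exponent, since both the powers and the juxtaposition peel off one
factor on the right. -/
theorem algOpPow_algAppend (A : H →L[ℂ] H) (n m : ℕ) (x : AlgPow H n) (y : AlgPow H m) :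
    algOpPow A (n + m) (algAppend H n m (x ⊗ₜ y)) =
      algAppend H n m (algOpPow A n x ⊗ₜ algOpPow A m y) := by
  induction m with
  | zero =>
    have h : ∀ z : AlgPow H n, algAppend H n 0 (z ⊗ₜ y) = algZero H y • z := fun z => rfl
    have h2 : algOpPow A 0 y = y := rfl
    rw [h2, h, h]
    exact map_smul (algOpPow A n) _ _
  | succ m ih =>
    obtain ⟨y, rfl⟩ := (algSucc H m).symm.surjective y
    induction y using TensorProduct.induction_on with
    | zero => simp only [map_zero, TensorProduct.tmul_zero]
    | add y₁ y₂ h₁ h₂ => simp only [map_add, TensorProduct.tmul_add, h₁, h₂]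
    | tmul y h =>
      rw [algAppend_succ_tmul, algOpPow_succ_apply, TensorProduct.mapL_tmul, algAppend_succ_tmul,
        ← ih]
      exact algOpPow_succ_apply A (n + m) (algAppend H n m (x ⊗ₜ y) ⊗ₜ h)

theorem opPow_powTmul (A : H →L[ℂ] H) (x : HilbertPow H n) (y : HilbertPow H m) :
    opPow A (n + m) (powTmul x y) = powTmul (opPow A n x) (opPow A m y) := by
  induction x, y using Completion.induction_on₂ with
  | hp =>
    refine isClosed_eq ((opPow A (n + m)).continuous.comp continuous_powTmul) ?_
    exact continuous_powTmul.comp (((opPow A n).continuous.comp continuous_fst).prodMk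
      ((opPow A m).continuous.comp continuous_snd))
  | ih x y =>
    rw [powTmul_coe, opPow, opPow, opPow, completion_apply_coe, completion_apply_coe,
      completion_apply_coe, powTmul_coe, algOpPow_algAppend]

/-- Elementary tensors are total, so operator identities on the joint power can be checked on them
alone. -/
theorem mem_of_powTmul_mem {V : Submodule ℂ (HilbertPow H (n + m))} (hV : IsClosed (V : Set (HilbertPow H (n + m))))
    (h : ∀ x y, powTmul x y ∈ V) (z : HilbertPow H (n + m)) : z ∈ V := by
  obtain ⟨z, rfl⟩ := (append H n m).surjective z
  induction z using Completion.induction_on with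
  | hp => exact hV.preimage (append H n m).continuous
  | ih z =>
    induction z using TensorProduct.induction_on with
    | zero => simp [Completion.coe_zero]
    | add x y hx hy => rw [Completion.coe_add, map_add]; exact V.add_mem hx hy
    | tmul x y => exact h x y

theorem powTmul_ext {f g : HilbertPow H (n + m) →L[ℂ] HilbertPow H (n + m)}
    (h : ∀ x y, f (powTmul x y) = g (powTmul x y)) : f = g := by
  ext z
  have := mem_of_powTmul_mem (V := LinearMap.ker (f - g).toLinearMap) (f - g).isClosed_ker
    (fun x y => by simp [h]) z
  simpa [sub_eq_zero] using this

theorem opPow_add (A : H →L[ℂ] H) (n m : ℕ) :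
    opPow A (n + m) = powTensor (opPow A n) (opPow A m) :=
  powTmul_ext fun x y => by rw [opPow_powTmul, powTensor_powTmul]

theorem powTensor_mul (S S' : HilbertPow H n →L[ℂ] HilbertPow H n)
    (T T' : HilbertPow H m →L[ℂ] HilbertPow H m) :
    powTensor S T * powTensor S' T' = powTensor (S * S') (T * T') :=
  powTmul_ext fun x y => by
    simp only [mul_apply_eq_comp, powTensor_powTmul]

theorem powTensor_one : powTensor (1 : HilbertPow H n →L[ℂ] HilbertPow H n)
    (1 : HilbertPow H m →L[ℂ] HilbertPow H m) = 1 :=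
  powTmul_ext fun x y => by simp only [powTensor_powTmul, one_apply_eq_self]

theorem star_powTensor (S : HilbertPow H n →L[ℂ] HilbertPow H n)
    (T : HilbertPow H m →L[ℂ] HilbertPow H m) :
    star (powTensor S T) = powTensor (star S) (star T) := by
  have h1 : star (opTensor S T) = opTensor (star S) (star T) :=
    star_completion (inner_mapL (fun x y => by rw [star_eq_adjoint, adjoint_inner_right])
      (fun x y => by rw [star_eq_adjoint, adjoint_inner_right]))
  symm
  refine (eq_adjoint_iff _ _).2 fun x y => ?_
  obtain ⟨x, rfl⟩ := (append H n m).surjective x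
  obtain ⟨y, rfl⟩ := (append H n m).surjective y
  change ⟪append H n m (opTensor (star S) (star T) ((append H n m).symm (append H n m x))), _⟫_ℂ =
    ⟪_, append H n m (opTensor S T ((append H n m).symm (append H n m y)))⟫_ℂ
  rw [LinearIsometryEquiv.symm_apply_apply, LinearIsometryEquiv.symm_apply_apply,
    LinearIsometryEquiv.inner_map_map, LinearIsometryEquiv.inner_map_map, ← h1, star_eq_adjoint,
    adjoint_inner_left]

theorem powTensor_nonneg {S : HilbertPow H n →L[ℂ] HilbertPow H n}
    {T : HilbertPow H m →L[ℂ] HilbertPow H m} (hS : 0 ≤ S) (hT : 0 ≤ T) : 0 ≤ powTensor S T := by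
  rw [← CFC.sqrt_mul_sqrt_self S, ← CFC.sqrt_mul_sqrt_self T, ← powTensor_mul]
  conv_rhs => enter [1]; rw [← isSelfAdjoint_sqrt S, ← isSelfAdjoint_sqrt T, ← star_powTensor]
  exact star_mul_self_nonneg _

theorem sqrt_powTensor {S : HilbertPow H n →L[ℂ] HilbertPow H n}
    {T : HilbertPow H m →L[ℂ] HilbertPow H m} (hS : 0 ≤ S) (hT : 0 ≤ T) :
    CFC.sqrt (powTensor S T) = powTensor (CFC.sqrt S) (CFC.sqrt T) := by
  refine CFC.sqrt_unique ?_ (powTensor_nonneg (CFC.sqrt_nonneg S) (CFC.sqrt_nonneg T))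
  rw [powTensor_mul, CFC.sqrt_mul_sqrt_self S, CFC.sqrt_mul_sqrt_self T]

/-- The product Hilbert basis of `H^{⊗ (n+m)}`. -/
theorem exists_hilbertBasis_powTmul {ι κ : Type*} (b : HilbertBasis ι ℂ (HilbertPow H n))
    (c : HilbertBasis κ ℂ (HilbertPow H m)) :
    ∃ d : HilbertBasis (ι × κ) ℂ (HilbertPow H (n + m)), ∀ p, d p = powTmul (b p.1) (c p.2) := by
  classical
  have ho : Orthonormal ℂ fun p : ι × κ => powTmul (b p.1) (c p.2) := by
    rw [orthonormal_iff_ite]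
    rintro ⟨i₁, i₂⟩ ⟨j₁, j₂⟩
    simp [inner_powTmul, orthonormal_iff_ite.mp b.orthonormal,
      orthonormal_iff_ite.mp c.orthonormal, ← ite_and, and_comm]
  set V := (Submodule.span ℂ (Set.range fun p : ι × κ => powTmul (b p.1) (c p.2))).topologicalClosure
  have hVc : IsClosed (V : Set (HilbertPow H (n + m))) := Submodule.isClosed_topologicalClosure _
  have hlin : ∀ y : HilbertPow H m, ∃ f : HilbertPow H n →L[ℂ] HilbertPow H (n + m),
      ∀ x, f x = powTmul x y := fun y =>
    ⟨((append H n m : _ →L[ℂ] HilbertPow H (n + m)) ∘L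
      (Completion.toComplL (𝕜 := ℂ) (E := HilbertPow H n ⊗[ℂ] HilbertPow H m))) ∘L
      (TensorProduct.mkL ℂ (HilbertPow H n) (HilbertPow H m)).flip y, fun x => rfl⟩
  have hlin' : ∀ x : HilbertPow H n, ∃ f : HilbertPow H m →L[ℂ] HilbertPow H (n + m),
      ∀ y, f y = powTmul x y := fun x =>
    ⟨((append H n m : _ →L[ℂ] HilbertPow H (n + m)) ∘L
      (Completion.toComplL (𝕜 := ℂ) (E := HilbertPow H n ⊗[ℂ] HilbertPow H m))) ∘L
      (TensorProduct.mkL ℂ (HilbertPow H n) (HilbertPow H m)) x, fun y => rfl⟩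
  -- Totality is obtained one factor at a time: first arbitrary `x` against a basis vector, then
  -- arbitrary `y`.
  have h1 : ∀ x j, powTmul x (c j) ∈ V := by
    intro x j
    obtain ⟨f, hf⟩ := hlin (c j)
    have hle : (Submodule.span ℂ (Set.range b)).topologicalClosure ≤ V.comap f.toLinearMap := by
      refine Submodule.topologicalClosure_minimal _ ?_ (hVc.preimage f.continuous)
      rw [Submodule.span_le]
      rintro _ ⟨i, rfl⟩
      exact Submodule.le_topologicalClosure _ (Submodule.subset_span ⟨(i, j), (hf _).symm⟩)
    rw [b.dense_span] at hle
    rw [← hf]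
    exact hle (Submodule.mem_top (x := x))
  have h2 : ∀ x y, powTmul x y ∈ V := by
    intro x y
    obtain ⟨f, hf⟩ := hlin' x
    have hle : (Submodule.span ℂ (Set.range c)).topologicalClosure ≤ V.comap f.toLinearMap := by
      refine Submodule.topologicalClosure_minimal _ ?_ (hVc.preimage f.continuous)
      rw [Submodule.span_le]
      rintro _ ⟨j, rfl⟩
      change f (c j) ∈ V
      rw [hf]
      exact h1 x j
    rw [c.dense_span] at hle
    rw [← hf]
    exact hle (Submodule.mem_top (x := y))
  refine ⟨HilbertBasis.mk ho fun z _ => mem_of_powTmul_mem hVc h2 z, fun p => ?_⟩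
  rw [HilbertBasis.coe_mk]

theorem hsSq_powTensor (S : HilbertPow H n →L[ℂ] HilbertPow H n)
    (T : HilbertPow H m →L[ℂ] HilbertPow H m) :
    hsSq (powTensor S T) = hsSq S * hsSq T := by
  obtain ⟨d, hd⟩ := exists_hilbertBasis_powTmul (stdBasis (HilbertPow H n))
    (stdBasis (HilbertPow H m))
  rw [hsSq_eq_tsum d, hsSq, hsSq, ← ENNReal.tsum_mul_right]
  simp only [hd, powTensor_powTmul, enorm_powTmul, ← ENNReal.tsum_mul_left, mul_pow]
  exact ENNReal.tsum_prod (f := fun i j => ‖S (stdBasis (HilbertPow H n) i)‖ₑ ^ 2 *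
    ‖T (stdBasis (HilbertPow H m) j)‖ₑ ^ 2)

/-- Square roots of tensor products are tensor products of square roots, and Hilbert-Schmidt norms
factor in a product basis. This multiplicativity drives both the geometric-mean bound and the tensor
power trick. -/
theorem sandwichTrace_powTensor [CompleteSpace H] {A : H →L[ℂ] H} (hA : 0 ≤ A)
    {X : HilbertPow H n →L[ℂ] HilbertPow H n} {Y : HilbertPow H m →L[ℂ] HilbertPow H m}
    (hX : 0 ≤ X) (hY : 0 ≤ Y) :
    sandwichTrace (opPow A (n + m)) (powTensor X Y) =
      sandwichTrace (opPow A n) X * sandwichTrace (opPow A m) Y := by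
  have hn := opPow_nonneg hA n
  have hm := opPow_nonneg hA m
  rw [sandwichTrace_eq_hsSq (opPow_nonneg hA _), sandwichTrace_eq_hsSq hn,
    sandwichTrace_eq_hsSq hm, opPow_add, sqrt_powTensor hn hm, sqrt_powTensor hX hY,
    powTensor_mul, hsSq_powTensor]

theorem norm_powTensor_le (S : HilbertPow H n →L[ℂ] HilbertPow H n)
    (T : HilbertPow H m →L[ℂ] HilbertPow H m) : ‖powTensor S T‖ ≤ ‖S‖ * ‖T‖ := by
  refine opNorm_le_bound _ (by positivity) fun x => ?_
  change ‖append H n m (opTensor S T ((append H n m).symm x))‖ ≤ _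
  rw [LinearIsometryEquiv.norm_map]
  refine (le_opNorm _ _).trans ?_
  rw [LinearIsometryEquiv.norm_map]
  gcongr
  exact (norm_completion_le _).trans (TensorProduct.norm_mapL_le S T)

theorem powTensor_le_one {X : HilbertPow H n →L[ℂ] HilbertPow H n}
    {Y : HilbertPow H m →L[ℂ] HilbertPow H m}
    (hX : 0 ≤ X) (hX1 : X ≤ 1) (hY : 0 ≤ Y) (hY1 : Y ≤ 1) : powTensor X Y ≤ 1 := by
  rw [← CStarAlgebra.norm_le_one_iff_of_nonneg _ hX] at hX1
  rw [← CStarAlgebra.norm_le_one_iff_of_nonneg _ hY] at hY1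
  rw [← CStarAlgebra.norm_le_one_iff_of_nonneg _ (powTensor_nonneg hX hY)]
  exact (norm_powTensor_le X Y).trans (mul_le_one₀ hX1 (norm_nonneg _) hY1)

end Append

end WeakMean

namespace WeakMean

/-! ### Separation for additive monoids of continuous functions. -/

section Minimax

variable {Y : Type*} [TopologicalSpace Y] [CompactSpace Y]

/-- Rounding the coefficients of `N • g` down to integers lands in `M`, at a cost that does not grow
with `N`. The functions with this property contain `M` and form a convex set. -/
theorem exists_natCast_smul_approx (M : AddSubmonoid C(Y, ℝ)) {g : C(Y, ℝ)}
    (hg : g ∈ convexHull ℝ (M : Set C(Y, ℝ))) :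
    ∃ K : ℝ, ∀ N : ℝ, 0 ≤ N → ∃ m ∈ M, ‖N • g - m‖ ≤ K := by
  have hsub : (M : Set C(Y, ℝ)) ⊆ {g | ∃ K : ℝ, ∀ N : ℝ, 0 ≤ N → ∃ m ∈ M, ‖N • g - m‖ ≤ K} := by
    intro g hg
    refine ⟨‖g‖, fun N hN => ⟨⌊N⌋₊ • g, M.nsmul_mem hg _, ?_⟩⟩
    rw [← Nat.cast_smul_eq_nsmul ℝ, ← sub_smul, norm_smul]
    refine mul_le_of_le_one_left (norm_nonneg _) ?_
    rw [Real.norm_eq_abs, abs_le]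
    constructor <;> linarith [Nat.floor_le hN, Nat.lt_floor_add_one N]
  refine convexHull_min hsub ?_ hg
  rintro g₁ ⟨K₁, h₁⟩ g₂ ⟨K₂, h₂⟩ a b ha hb -
  refine ⟨K₁ + K₂, fun N hN => ?_⟩
  obtain ⟨m₁, hm₁, hn₁⟩ := h₁ (N * a) (by positivity)
  obtain ⟨m₂, hm₂, hn₂⟩ := h₂ (N * b) (by positivity)
  refine ⟨m₁ + m₂, M.add_mem hm₁ hm₂, ?_⟩
  have : N • (a • g₁ + b • g₂) - (m₁ + m₂) = ((N * a) • g₁ - m₁) + ((N * b) • g₂ - m₂) := by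
    rw [smul_add, smul_smul, smul_smul]
    abel
  rw [this]
  exact (norm_add_le _ _).trans (add_le_add hn₁ hn₂)

theorem not_forall_neg_of_mem_convexHull [Nonempty Y] (M : AddSubmonoid C(Y, ℝ))
    (hM : ∀ g ∈ M, ∃ y, 0 ≤ g y) {g : C(Y, ℝ)} (hg : g ∈ convexHull ℝ (M : Set C(Y, ℝ))) :
    ¬ ∀ y, g y < 0 := by
  intro hneg
  obtain ⟨y₀, -, hy₀⟩ := isCompact_univ.exists_isMaxOn Set.univ_nonempty g.continuous.continuousOn
  obtain ⟨K, hK⟩ := exists_natCast_smul_approx M hg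
  have h0 := hneg y₀
  have hK0 : 0 ≤ K := by
    obtain ⟨m, -, h⟩ := hK 0 le_rfl
    exact (norm_nonneg _).trans h
  -- This multiple brings the maximum of `g` down to `-(K + 1)`, so an error of at most `K` leaves
  -- `m ≤ -1` everywhere.
  obtain ⟨m, hm, hmn⟩ := hK ((K + 1) / (-g y₀)) (div_nonneg (by linarith) (by linarith))
  obtain ⟨y, hy⟩ := hM m hm
  have h1 := (ContinuousMap.norm_coe_le_norm _ y).trans hmn
  simp only [ContinuousMap.sub_apply, ContinuousMap.smul_apply, smul_eq_mul, Real.norm_eq_abs]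
    at h1
  have h2 : g y ≤ g y₀ := hy₀ (Set.mem_univ y)
  have h3 : (K + 1) / (-g y₀) * g y ≤ (K + 1) / (-g y₀) * g y₀ :=
    mul_le_mul_of_nonneg_left h2 (div_nonneg (by linarith) (by linarith))
  have h4 : (K + 1) / (-g y₀) * g y₀ = -(K + 1) := by
    rw [div_neg, neg_mul, div_mul_cancel₀ _ h0.ne]
  rw [abs_le] at h1
  linarith [h1.1]

/-- If every element of an additive monoid of continuous functions on a compact Hausdorff space is
non-negative somewhere, then some probability measure gives every element a non-negative
integral. -/
theorem exists_probabilityMeasure_integral_nonneg [T2Space Y] [Nonempty Y] [MeasurableSpace Y]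
    [BorelSpace Y] (M : AddSubmonoid C(Y, ℝ)) (hM : ∀ g ∈ M, ∃ y, 0 ≤ g y) :
    ∃ ν : Measure Y, IsProbabilityMeasure ν ∧ ∀ g ∈ M, 0 ≤ ∫ y, g y ∂ν := by
  set s : Set C(Y, ℝ) := {f | ∀ y, f y < 0} with hs
  have hso : IsOpen s := by
    have := ContinuousMap.isOpen_setOfPred_mapsTo (X := Y) (Y := ℝ) isCompact_univ
      (isOpen_Iio (a := (0 : ℝ)))
    simpa [Set.MapsTo] using this
  have hsc : Convex ℝ s := by
    intro f hf g hg a b ha hb hab y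
    simp only [ContinuousMap.add_apply, ContinuousMap.smul_apply, smul_eq_mul]
    rcases ha.eq_or_lt with rfl | ha
    · have : b = 1 := by linarith
      simpa [this] using hg y
    · nlinarith [hf y, hg y, mul_neg_of_pos_of_neg ha (hf y),
        mul_nonpos_of_nonneg_of_nonpos hb (hg y).le]
  have hd : Disjoint s (convexHull ℝ (M : Set C(Y, ℝ))) :=
    Set.disjoint_left.2 fun g hg hgM => not_forall_neg_of_mem_convexHull M hM hgM hg
  obtain ⟨φ, u, hφs, hφM⟩ := geometric_hahn_banach_open hsc hso (convex_convexHull ℝ _) hd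
  have hu0 : u ≤ 0 := by
    have := hφM 0 (subset_convexHull ℝ _ M.zero_mem)
    simpa using this
  -- `-f - c` is strictly negative for `f ≥ 0` and `c > 0`, so it lies on the open side of the
  -- hyperplane.
  have hneg : ∀ f : C(Y, ℝ), (∀ y, 0 ≤ f y) → ∀ c : ℝ, 0 < c → -φ f - c * φ 1 < u := by
    intro f hf c hc
    have := hφs (-f - c • 1) fun y => by
      simp only [ContinuousMap.sub_apply, ContinuousMap.neg_apply, ContinuousMap.smul_apply,
        ContinuousMap.one_apply, smul_eq_mul]
      linarith [hf y]
    simpa using this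
  have hpos : 0 < φ 1 := by
    have := hneg 0 (fun y => le_rfl) 1 one_pos
    simp only [map_zero] at this
    linarith
  have hφ0 : ∀ f : C(Y, ℝ), (∀ y, 0 ≤ f y) → 0 ≤ φ f := by
    intro f hf
    by_contra! h
    have := hneg f hf (-φ f / φ 1) (div_pos (by linarith) hpos)
    rw [div_mul_cancel₀ _ hpos.ne'] at this
    linarith
  -- `φ (N • g) = N φ g` is bounded below by `u` for every `N`, which excludes `φ g < 0`.
  have hMφ : ∀ g ∈ M, 0 ≤ φ g := by
    intro g hg
    by_contra! h
    obtain ⟨N, hN⟩ := exists_nat_gt (u / φ g)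
    have h1 := hφM _ (subset_convexHull ℝ _ (M.nsmul_mem hg N))
    rw [map_nsmul, nsmul_eq_mul] at h1
    rw [div_lt_iff_of_neg h] at hN
    linarith
  -- Riesz-Markov is applied to `φ` normalised by `φ 1`; on a compact space every continuous
  -- function is compactly supported.
  let ψ : CompactlySupportedContinuousMap Y ℝ →ₗ[ℝ] ℝ :=
    { toFun := fun f => (φ 1)⁻¹ * φ f.toContinuousMap
      map_add' := fun f g => by
        have : (f + g).toContinuousMap = f.toContinuousMap + g.toContinuousMap := rfl
        rw [this, map_add, mul_add]
      map_smul' := fun c f => by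
        have : (c • f).toContinuousMap = c • f.toContinuousMap := rfl
        rw [this, map_smul, smul_eq_mul, RingHom.id_apply, smul_eq_mul]
        ring }
  let Λ := PositiveLinearMap.mk₀ ψ fun f hf =>
    mul_nonneg (inv_nonneg.2 hpos.le) (hφ0 f.toContinuousMap fun y => CompactlySupportedContinuousMap.le_def.1 hf y)
  have hint : ∀ g : C(Y, ℝ), ∫ y, g y ∂(RealRMK.rieszMeasure Λ) = (φ 1)⁻¹ * φ g := fun g =>
    RealRMK.integral_rieszMeasure Λ (CompactlySupportedContinuousMap.continuousMapEquiv g)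
  refine ⟨RealRMK.rieszMeasure Λ, ⟨?_⟩, fun g hg => ?_⟩
  · have := hint 1
    rw [inv_mul_cancel₀ hpos.ne'] at this
    simp only [ContinuousMap.one_apply, integral_const, smul_eq_mul, mul_one] at this
    rwa [measureReal_def, ENNReal.toReal_eq_one_iff] at this
  · rw [hint]
    exact mul_nonneg (inv_nonneg.2 hpos.le) (hMφ g hg)

end Minimax

end WeakMean

namespace WeakMean

/-! ### Geometric means: Jensen's inequality and the multiplicative minimax theorem. -/

section GeometricMean

open Topology

theorem toENNReal_log_ofReal (x : ℝ) (hx : 0 ≤ x) :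
    (ENNReal.log (ENNReal.ofReal x)).toENNReal = ENNReal.ofReal (Real.log x) := by
  rcases hx.eq_or_lt with rfl | hx
  · simp
  · rw [ENNReal.log_ofReal_of_pos hx, EReal.toENNReal_of_ne_top (EReal.coe_ne_top _),
      EReal.toReal_coe]

theorem toENNReal_neg_log_ofReal {x : ℝ} (hx : 0 < x) :
    (-ENNReal.log (ENNReal.ofReal x)).toENNReal = ENNReal.ofReal (-Real.log x) := by
  rw [ENNReal.log_ofReal_of_pos hx, ← EReal.coe_neg,
    EReal.toENNReal_of_ne_top (EReal.coe_ne_top _), EReal.toReal_coe]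

/-- The tangent inequality `log x ≤ log m + x / m - 1`, rearranged so that only positive and
negative parts occur and nothing is subtracted in `[0, ∞]`. Integrated with `m` the mean, it is
Jensen's inequality for `log`. -/
theorem toENNReal_log_add_le (x m : ℝ≥0∞) (hm : m ≠ 0) (hm' : m ≠ ∞) :
    (ENNReal.log x).toENNReal + 1 + (-ENNReal.log m).toENNReal ≤
      (-ENNReal.log x).toENNReal + (ENNReal.log m).toENNReal + x / m := by
  induction x with
  | top => simp [ENNReal.top_div_of_ne_top hm']
  | coe x =>
    lift m to NNReal using hm'
    rcases eq_or_ne x 0 with rfl | hx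
    · simp
    have hx' : (0 : ℝ) < x := by positivity
    have hm0 : m ≠ 0 := by simpa using hm
    have hm' : (0 : ℝ) < m := by positivity
    rw [← ENNReal.ofReal_coe_nnreal, ← ENNReal.ofReal_coe_nnreal, ← ENNReal.ofReal_div_of_pos hm',
      toENNReal_log_ofReal _ hx'.le, toENNReal_log_ofReal _ hm'.le, toENNReal_neg_log_ofReal hx',
      toENNReal_neg_log_ofReal hm']
    have h1 := Real.log_le_sub_one_of_pos (div_pos hx' hm')
    rw [Real.log_div hx'.ne' hm'.ne'] at h1
    simp only [ENNReal.ofReal, ← ENNReal.coe_one, ← ENNReal.coe_add, ENNReal.coe_le_coe,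
      ← NNReal.coe_le_coe, NNReal.coe_add, Real.coe_toNNReal', NNReal.coe_one]
    rw [max_eq_left (div_pos hx' hm').le]
    have h2 := max_zero_sub_eq_self (Real.log x)
    have h3 := max_zero_sub_eq_self (Real.log m)
    linarith

variable {Y : Type*} [MeasurableSpace Y]

/-- The geometric mean is bounded by the arithmetic mean. -/
theorem geomMean_le_lintegral (ν : Measure Y) [IsProbabilityMeasure ν] {f : Y → ℝ≥0∞}
    (hf : Measurable f) : geomMean ν f ≤ ∫⁻ y, f y ∂ν := by
  have hP : Measurable fun y => (ENNReal.log (f y)).toENNReal :=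
    measurable_ereal_toENNReal.comp (ENNReal.measurable_log.comp hf)
  have hN : Measurable fun y => (-ENNReal.log (f y)).toENNReal :=
    measurable_ereal_toENNReal.comp (ENNReal.measurable_log.comp hf).neg
  set m := ∫⁻ y, f y ∂ν with hm
  by_cases h0 : m = 0
  · have hae : f =ᵐ[ν] 0 := (lintegral_eq_zero_iff hf).1 (hm ▸ h0)
    have h1 : ∫⁻ y, (ENNReal.log (f y)).toENNReal ∂ν = 0 := by
      rw [lintegral_eq_zero_iff hP]
      filter_upwards [hae] with y hy
      simp [hy]
    have h2 : ∫⁻ y, (-ENNReal.log (f y)).toENNReal ∂ν = ∞ := by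
      have : (fun y => (-ENNReal.log (f y)).toENNReal) =ᵐ[ν] fun _ => ∞ := by
        filter_upwards [hae] with y hy
        simp [hy]
      rw [lintegral_congr_ae this]
      simp
    rw [geomMean, extIntegral, h1, h2]
    simp
  by_cases ht : m = ∞
  · rw [ht]
    exact le_top
  have key : ∫⁻ y, (ENNReal.log (f y)).toENNReal ∂ν + 1 + (-ENNReal.log m).toENNReal ≤
      ∫⁻ y, (-ENNReal.log (f y)).toENNReal ∂ν + (ENNReal.log m).toENNReal + 1 := by
    have := lintegral_mono (μ := ν) fun y => toENNReal_log_add_le (f y) m h0 ht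
    rw [lintegral_add_right _ measurable_const, lintegral_add_right _ measurable_const,
      lintegral_add_left (f := fun y => (-ENNReal.log (f y)).toENNReal + (ENNReal.log m).toENNReal)
        (hN.add measurable_const), lintegral_add_right _ measurable_const] at this
    simp only [lintegral_const, measure_univ, mul_one] at this
    have h3 : ∫⁻ y, f y / m ∂ν = 1 := by
      simp only [div_eq_mul_inv]
      rw [lintegral_mul_const _ hf, ← hm, ENNReal.mul_inv_cancel h0 ht]
    rwa [h3] at this
  rw [geomMean, extIntegral]
  clear_value m
  generalize ∫⁻ y, (ENNReal.log (f y)).toENNReal ∂ν = P at *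
  generalize ∫⁻ y, (-ENNReal.log (f y)).toENNReal ∂ν = N at *
  lift m to NNReal using ht
  have hm0 : (0 : ℝ) < m := by
    have : m ≠ 0 := by simpa using h0
    positivity
  rw [← ENNReal.ofReal_coe_nnreal, toENNReal_log_ofReal _ hm0.le, toENNReal_neg_log_ofReal hm0]
    at key
  -- An infinite negative part makes the geometric mean `0`, whatever `P` is, since `⊤ - ⊤ = ⊥` in
  -- `EReal`.
  by_cases hNt : N = ∞
  · rw [hNt]
    simp
  have hPt : P ≠ ∞ := by
    rintro rfl
    simp [hNt] at key
  lift N to NNReal using hNt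
  lift P to NNReal using hPt
  simp only [ENNReal.ofReal, ← ENNReal.coe_one, ← ENNReal.coe_add, ENNReal.coe_le_coe,
      ← NNReal.coe_le_coe, NNReal.coe_add, Real.coe_toNNReal', NNReal.coe_one] at key
  have h3 := max_zero_sub_eq_self (Real.log m)
  have h4 : (P : ℝ) - N ≤ Real.log m := by linarith
  have h5 : ((P : ℝ≥0∞) : EReal) - ((N : ℝ≥0∞) : EReal) = (((P : ℝ) - N : ℝ) : EReal) := rfl
  rw [h5, EReal.exp_coe, ← ENNReal.ofReal_coe_nnreal]
  refine ENNReal.ofReal_le_ofReal ?_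
  rwa [← Real.le_log_iff_exp_le hm0]

variable [TopologicalSpace Y] [CompactSpace Y] [BorelSpace Y]

/-- The space of operators need not be separable, but the range of `f` is compact, hence separable
and bounded. -/
theorem integrable_of_continuous {E : Type*} [NormedAddCommGroup E] (ν : Measure Y)
    [IsFiniteMeasure ν] {f : Y → E} (hf : Continuous f) : Integrable f ν := by
  have hs : StronglyMeasurable f := by
    borelize E
    refine stronglyMeasurable_iff_measurable_separable.2 ⟨hf.measurable, ?_⟩
    exact (isCompact_range hf).isSeparable
  obtain ⟨C, hC⟩ := (isCompact_range hf).isBounded.exists_norm_le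
  exact Integrable.of_bound hs.aestronglyMeasurable C
    (Eventually.of_forall fun y => hC _ ⟨y, rfl⟩)

theorem log_add_le {x ε : ℝ} (hx : 0 ≤ x) (hε : 0 < ε) :
    Real.log (x + ε) ≤ max (Real.log x) 0 + ε := by
  rcases le_total x 1 with h | h
  · have := Real.log_le_sub_one_of_pos (add_pos_of_nonneg_of_pos hx hε)
    linarith [le_max_right (Real.log x) 0]
  · have hx0 : 0 < x := by linarith
    have h1 : x + ε = x * (1 + ε / x) := by field_simp
    have h2 := Real.log_le_sub_one_of_pos (show 0 < 1 + ε / x by positivity)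
    rw [h1, Real.log_mul hx0.ne' (by positivity)]
    have h3 : ε / x ≤ ε := div_le_self hε.le h
    linarith [le_max_left (Real.log x) 0]

/-- As `ε` decreases to `0` the negative parts of `log (a + ε)` increase to that of `log a`,
infinite where `a` vanishes. Monotone convergence applies to them, and `log_add_le` controls the
positive parts. -/
theorem ofReal_le_geomMean (ν : Measure Y) [IsProbabilityMeasure ν] {a : Y → ℝ}
    (hac : Continuous a) (ha : ∀ y, 0 ≤ a y) {c : ℝ} (hc : 0 < c)
    (h : ∀ ε : ℝ, 0 < ε → Real.log c ≤ ∫ y, Real.log (a y + ε) ∂ν) :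
    ENNReal.ofReal c ≤ geomMean ν fun y => ENNReal.ofReal (a y) := by
  have hε : ∀ n : ℕ, (0 : ℝ) < 1 / ((n : ℝ) + 1) := fun n => by positivity
  have hlim : Tendsto (fun n : ℕ => (1 : ℝ) / ((n : ℝ) + 1)) atTop (𝓝 0) :=
    tendsto_one_div_add_atTop_nhds_zero_nat
  have hanti : Antitone fun n : ℕ => (1 : ℝ) / ((n : ℝ) + 1) := fun m n hmn => by
    simp only
    gcongr
  have hpos : ∀ (n : ℕ) y, 0 < a y + 1 / ((n : ℝ) + 1) := fun n y =>
    add_pos_of_nonneg_of_pos (ha y) (by positivity)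
  set P := ∫⁻ y, ENNReal.ofReal (Real.log (a y)) ∂ν with hP
  have hPt : P ≠ ∞ := by
    refine ne_top_of_le_ne_top (integrable_of_continuous ν hac).lintegral_lt_top.ne ?_
    exact lintegral_mono fun y => ENNReal.ofReal_le_ofReal (Real.log_le_self (ha y))
  let N : ℕ → Y → ℝ≥0∞ := fun n y => ENNReal.ofReal (-Real.log (a y + 1 / ((n : ℝ) + 1)))
  have hNm : ∀ n, Measurable (N n) := fun n => by
    have := hac.measurable
    fun_prop
  have hmono : Monotone N := fun m n hmn y => by
    refine ENNReal.ofReal_le_ofReal (neg_le_neg (Real.log_le_log (hpos n y) ?_))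
    linarith [hanti hmn]
  have hlogc : ∀ n : ℕ, Continuous fun y => Real.log (a y + 1 / ((n : ℝ) + 1)) := fun n =>
    Continuous.log (by fun_prop) fun y => (hpos n y).ne'
  have hNt : ∀ n, ∫⁻ y, N n y ∂ν ≠ ∞ := fun n =>
    (integrable_of_continuous ν (hlogc n).neg).lintegral_lt_top.ne
  have h1 : ∀ n : ℕ, (∫⁻ y, N n y ∂ν).toReal ≤ P.toReal + 1 / ((n : ℝ) + 1) - Real.log c := by
    intro n
    have h2 := h _ (hε n)
    rw [integral_eq_lintegral_pos_part_sub_lintegral_neg_part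
      (integrable_of_continuous ν (hlogc n))] at h2
    have h3 : ∫⁻ y, ENNReal.ofReal (Real.log (a y + 1 / ((n : ℝ) + 1))) ∂ν ≤
        P + ENNReal.ofReal (1 / ((n : ℝ) + 1)) := by
      calc _ ≤ ∫⁻ y, (ENNReal.ofReal (Real.log (a y)) +
            ENNReal.ofReal (1 / ((n : ℝ) + 1))) ∂ν := by
            refine lintegral_mono fun y => ?_
            refine (ENNReal.ofReal_le_ofReal (log_add_le (ha y) (hε n))).trans ?_
            refine ENNReal.ofReal_add_le.trans ?_
            simp
        _ = _ := by
            rw [lintegral_add_right _ measurable_const]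
            simp [hP]
    have h4 := ENNReal.toReal_mono (by finiteness) h3
    rw [ENNReal.toReal_add hPt (by finiteness), ENNReal.toReal_ofReal (hε n).le] at h4
    change _ ≤ _ - (∫⁻ y, N n y ∂ν).toReal at h2
    linarith
  -- The negative integrals increase with the index, so each inherits the bounds of all later ones
  -- and the error `1 / (n + 1)` disappears.
  have h5 : ∀ n : ℕ, (∫⁻ y, N n y ∂ν).toReal ≤ P.toReal - Real.log c := by
    intro n
    have hl : Tendsto (fun n : ℕ => P.toReal + 1 / ((n : ℝ) + 1) - Real.log c) atTop
        (𝓝 (P.toReal - Real.log c)) := by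
      simpa using (hlim.const_add P.toReal).sub_const (Real.log c)
    refine ge_of_tendsto hl (eventually_atTop.2 ⟨n, fun j hj => ?_⟩)
    exact (ENNReal.toReal_mono (hNt j) (lintegral_mono (hmono hj))).trans (h1 j)
  have hsup : ∀ y, (-ENNReal.log (ENNReal.ofReal (a y))).toENNReal = ⨆ n, N n y := by
    intro y
    refine (iSup_eq_of_tendsto (fun m n hmn => hmono hmn y) ?_).symm
    have ht : Tendsto (fun n : ℕ => a y + 1 / ((n : ℝ) + 1)) atTop (𝓝 (a y)) := by
      simpa using hlim.const_add (a y)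
    rcases (ha y).eq_or_lt with h0 | h0
    · rw [← h0]
      simp only [ENNReal.ofReal_zero, ENNReal.log_zero, EReal.neg_bot, EReal.toENNReal_top, N]
      refine ENNReal.tendsto_ofReal_atTop.comp (tendsto_neg_atBot_atTop.comp ?_)
      refine (Real.tendsto_log_nhdsGT_zero).comp (tendsto_nhdsWithin_iff.2 ⟨?_, ?_⟩)
      · rw [← h0] at ht
        simpa only [← h0] using ht
      · exact Eventually.of_forall fun n => hpos n y
    · rw [toENNReal_neg_log_ofReal h0]
      exact ENNReal.tendsto_ofReal (ht.log h0.ne').neg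
  have h6 : ∫⁻ y, (-ENNReal.log (ENNReal.ofReal (a y))).toENNReal ∂ν ≤
      ENNReal.ofReal (P.toReal - Real.log c) := by
    simp only [hsup]
    rw [lintegral_iSup hNm hmono]
    refine iSup_le fun n => ?_
    rw [← ENNReal.ofReal_toReal (hNt n)]
    exact ENNReal.ofReal_le_ofReal (h5 n)
  have h7 : 0 ≤ P.toReal - Real.log c := ENNReal.toReal_nonneg.trans (h5 0)
  rw [geomMean, extIntegral]
  simp only [toENNReal_log_ofReal _ (ha _)]
  rw [← hP]
  generalize ∫⁻ y, (-ENNReal.log (ENNReal.ofReal (a y))).toENNReal ∂ν = M at *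
  have hMt : M ≠ ∞ := ne_top_of_le_ne_top ENNReal.ofReal_ne_top h6
  clear_value P
  lift M to NNReal using hMt
  lift P to NNReal using hPt
  have h8 : ((P : ℝ≥0∞) : EReal) - ((M : ℝ≥0∞) : EReal) = (((P : ℝ) - M : ℝ) : EReal) := rfl
  rw [h8, EReal.exp_coe]
  refine ENNReal.ofReal_le_ofReal ?_
  rw [← Real.log_le_iff_le_exp hc]
  have := ENNReal.toReal_mono ENNReal.ofReal_ne_top h6
  rw [ENNReal.toReal_ofReal h7, ENNReal.coe_toReal, ENNReal.coe_toReal] at this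
  linarith

/-- A minimax theorem for geometric means: `𝒬` is a multiplicatively closed set of pairs
`(a, c)` with `c ≤ sup a`. -/
theorem exists_le_geomMean [T2Space Y] [Nonempty Y] (𝒬 : Set (C(Y, ℝ) × ℝ))
    (ha : ∀ p ∈ 𝒬, ∀ y, 0 ≤ p.1 y) (hmul : ∀ p ∈ 𝒬, ∀ q ∈ 𝒬, p * q ∈ 𝒬)
    (hle : ∀ p ∈ 𝒬, ∃ y, p.2 ≤ p.1 y) :
    ∃ ν : Measure Y, IsProbabilityMeasure ν ∧ ∀ p ∈ 𝒬,
      ENNReal.ofReal p.2 ≤ geomMean ν fun y => ENNReal.ofReal (p.1 y) := by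
  -- Adding `ε` keeps the logarithm finite and continuous where `p.1` vanishes; pairs with `p.2 ≤ 0`
  -- are left out because the claim for them is trivial.
  set 𝒢 : Set C(Y, ℝ) := {g | ∃ p ∈ 𝒬, 0 < p.2 ∧ ∃ ε : ℝ, 0 < ε ∧
    ∀ y, g y = Real.log (p.1 y + ε) - Real.log p.2}
  -- Every non-zero element of the monoid dominates `log (p.1 / p.2)` for a single pair `p`, the
  -- product of the pairs involved. An inequality is all that survives, because the shifts by `ε` do
  -- not multiply to a shift.
  have hM : ∀ g ∈ AddSubmonoid.closure 𝒢,
      g = 0 ∨ ∃ p ∈ 𝒬, 0 < p.2 ∧ ∀ y, p.1 y ≤ p.2 * Real.exp (g y) := by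
    intro g hg
    induction hg using AddSubmonoid.closure_induction with
    | mem g hg =>
      obtain ⟨p, hp, hp2, ε, hε, hgy⟩ := hg
      refine Or.inr ⟨p, hp, hp2, fun y => ?_⟩
      have h0 : 0 < p.1 y + ε := add_pos_of_nonneg_of_pos (ha p hp y) hε
      rw [hgy, Real.exp_sub, Real.exp_log h0, Real.exp_log hp2, mul_div_cancel₀ _ hp2.ne']
      linarith
    | zero => exact Or.inl rfl
    | add g₁ g₂ _ _ h₁ h₂ =>
      rcases h₁ with rfl | ⟨p, hp, hp2, h₁⟩
      · simpa using h₂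
      rcases h₂ with rfl | ⟨q, hq, hq2, h₂⟩
      · rw [add_zero]
        exact Or.inr ⟨p, hp, hp2, h₁⟩
      refine Or.inr ⟨p * q, hmul p hp q hq, mul_pos hp2 hq2, fun y => ?_⟩
      rw [ContinuousMap.add_apply, Real.exp_add]
      calc p.1 y * q.1 y ≤ (p.2 * Real.exp (g₁ y)) * (q.2 * Real.exp (g₂ y)) :=
            mul_le_mul (h₁ y) (h₂ y) (ha q hq y) (by positivity)
        _ = p.2 * q.2 * (Real.exp (g₁ y) * Real.exp (g₂ y)) := by ring
  obtain ⟨ν, hν, hint⟩ := exists_probabilityMeasure_integral_nonneg (AddSubmonoid.closure 𝒢) (by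
    intro g hg
    rcases hM g hg with rfl | ⟨p, hp, hp2, h⟩
    · exact ⟨Classical.arbitrary Y, le_rfl⟩
    · obtain ⟨y, hy⟩ := hle p hp
      refine ⟨y, ?_⟩
      have := hy.trans (h y)
      rwa [le_mul_iff_one_le_right hp2, Real.one_le_exp_iff] at this)
  refine ⟨ν, hν, fun p hp => ?_⟩
  rcases le_or_gt p.2 0 with h0 | h0
  · rw [ENNReal.ofReal_of_nonpos h0]
    exact zero_le
  refine ofReal_le_geomMean ν p.1.continuous (ha p hp) h0 fun ε hε => ?_
  have hcont : Continuous fun y => Real.log (p.1 y + ε) :=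
    Continuous.log (by fun_prop) fun y => (add_pos_of_nonneg_of_pos (ha p hp y) hε).ne'
  have := hint ⟨fun y => Real.log (p.1 y + ε) - Real.log p.2, by fun_prop⟩
    (AddSubmonoid.subset_closure ⟨p, hp, h0, ε, hε, fun y => rfl⟩)
  simp only [ContinuousMap.coe_mk] at this
  rw [integral_sub (integrable_of_continuous ν hcont) (integrable_const _)] at this
  simpa using this

end GeometricMean

end WeakMean

namespace WeakMean

open ContinuousLinearMap

/-! ### Traces of averages of operators. -/

section Averages

variable {K : Type*} [NormedAddCommGroup K] [InnerProductSpace ℂ K] [CompleteSpace K]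

theorem sandwichTrace_eq_tsum (A X : K →L[ℂ] K) : sandwichTrace A X =
    ∑' i, ENNReal.ofReal
      (⟪CFC.sqrt X (stdBasis K i), A (CFC.sqrt X (stdBasis K i))⟫_ℂ).re := by
  refine tsum_congr fun i => ?_
  rw [mul_apply_eq_comp, mul_apply_eq_comp, ← adjoint_inner_left, ← star_eq_adjoint,
    isSelfAdjoint_sqrt]

variable {Y : Type*} [TopologicalSpace Y] [CompactSpace Y] [MeasurableSpace Y] [BorelSpace Y]
  (ν : Measure Y) {F : Y → K →L[ℂ] K}

theorem re_inner_integral [IsFiniteMeasure ν] (hF : Continuous F) (x : K) :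
    (⟪x, (∫ y, F y ∂ν) x⟫_ℂ).re = ∫ y, (⟪x, F y x⟫_ℂ).re ∂ν := by
  have hFi := integrable_of_continuous ν hF
  rw [integral_apply hFi, ← integral_inner (𝕜 := ℂ) (hFi.apply_continuousLinearMap x)]
  exact (integral_re (𝕜 := ℂ)
    (Integrable.const_inner (𝕜 := ℂ) x (hFi.apply_continuousLinearMap x))).symm

theorem ofReal_re_inner_integral [IsFiniteMeasure ν] (hF : Continuous F) (hF0 : ∀ y, 0 ≤ F y)
    (x : K) : ENNReal.ofReal (⟪x, (∫ y, F y ∂ν) x⟫_ℂ).re =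
      ∫⁻ y, ENNReal.ofReal (⟪x, F y x⟫_ℂ).re ∂ν := by
  have hc : Continuous fun y => (⟪x, F y x⟫_ℂ).re :=
    Complex.continuous_re.comp (continuous_const.inner (hF.clm_apply continuous_const))
  rw [re_inner_integral ν hF, ofReal_integral_eq_lintegral_ofReal (integrable_of_continuous ν hc)]
  exact Eventually.of_forall fun y => re_inner_nonneg (hF0 y) x

omit [CompleteSpace K] [CompactSpace Y] in
theorem measurable_ofReal_re_inner (hF : Continuous F) (x : K) :
    Measurable fun y => ENNReal.ofReal (⟪x, F y x⟫_ℂ).re := by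
  have hc : Continuous fun y => (⟪x, F y x⟫_ℂ).re :=
    Complex.continuous_re.comp (continuous_const.inner (hF.clm_apply continuous_const))
  exact hc.measurable.ennreal_ofReal

omit [TopologicalSpace Y] [CompactSpace Y] [BorelSpace Y] in
theorem integral_operator_nonneg (hF0 : ∀ y, 0 ≤ F y) : 0 ≤ ∫ y, F y ∂ν :=
  integral_nonneg hF0

/-- Tonelli's theorem for the trace against a trace-class operator. -/
theorem sandwichTrace_integral [IsFiniteMeasure ν] (hF : Continuous F) (hF0 : ∀ y, 0 ≤ F y)
    {ρ : K →L[ℂ] K} (hρ : 0 ≤ ρ) (hρt : psdTrace ρ ≠ ∞) :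
    sandwichTrace (∫ y, F y ∂ν) ρ = ∫⁻ y, sandwichTrace (F y) ρ ∂ν := by
  have hfin : hsSq (CFC.sqrt ρ) ≠ ∞ := by rwa [← psdTrace_eq_hsSq_sqrt hρ]
  -- The Hilbert basis may be uncountable, but `√ρ` is Hilbert-Schmidt and kills all but countably
  -- many basis vectors, so sum and integral can be exchanged.
  set s : Set (basisIndex K) := Function.support fun i => ‖CFC.sqrt ρ (stdBasis K i)‖ₑ ^ 2 with hs
  have hcount : s.Countable := Summable.countable_support_ennreal hfin
  have : Countable s := hcount.to_subtype
  have hsupp : ∀ A : K →L[ℂ] K, sandwichTrace A ρ = ∑' i : s, ENNReal.ofReal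
      (⟪CFC.sqrt ρ (stdBasis K i), A (CFC.sqrt ρ (stdBasis K i))⟫_ℂ).re := by
    intro A
    rw [sandwichTrace_eq_tsum]
    symm
    refine tsum_subtype_eq_of_support_subset (f := fun i => ENNReal.ofReal
      (⟪CFC.sqrt ρ (stdBasis K i), A (CFC.sqrt ρ (stdBasis K i))⟫_ℂ).re) fun i hi => ?_
    contrapose! hi
    have h0 : CFC.sqrt ρ (stdBasis K i) = 0 := by simpa [hs] using hi
    simp [h0]
  simp only [hsupp]
  rw [lintegral_tsum fun i => (measurable_ofReal_re_inner hF _).aemeasurable]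
  exact tsum_congr fun i => ofReal_re_inner_integral ν hF hF0 _

/-- Here `X` need not be trace-class: only finite partial sums are exchanged with the integral, so
the size of the basis does not matter. -/
theorem sandwichTrace_integral_le [IsProbabilityMeasure ν] (hF : Continuous F)
    (hF0 : ∀ y, 0 ≤ F y) (X : K →L[ℂ] K) :
    sandwichTrace (∫ y, F y ∂ν) X ≤ ⨆ y, sandwichTrace (F y) X := by
  rw [sandwichTrace_eq_tsum, ENNReal.tsum_eq_iSup_sum]
  refine iSup_le fun s => ?_
  simp only [ofReal_re_inner_integral ν hF hF0]
  rw [← lintegral_finsetSum s fun i _ => measurable_ofReal_re_inner hF _]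
  refine (lintegral_mono (g := fun _ => ⨆ y, sandwichTrace (F y) X) fun y => ?_).trans ?_
  · refine le_iSup_of_le y ?_
    rw [sandwichTrace_eq_tsum]
    exact ENNReal.sum_le_tsum s
  · simp

end Averages

/-! ### From trace inequalities to operator inequalities. -/

section Resolvent

variable {K : Type*} [NormedAddCommGroup K] [InnerProductSpace ℂ K] [CompleteSpace K]

theorem isUnit_add_smul_one {D : K →L[ℂ] K} (hD : 0 ≤ D) {ε : ℝ} (hε : 0 < ε) :
    0 ≤ D + ε • (1 : K →L[ℂ] K) ∧ IsUnit (D + ε • (1 : K →L[ℂ] K)) := by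
  have h1 : IsStrictlyPositive (ε • (1 : K →L[ℂ] K)) :=
    ⟨smul_nonneg hε.le zero_le_one, by
      rw [← Algebra.algebraMap_eq_smul_one]
      exact (isUnit_iff_ne_zero.2 hε.ne').map (algebraMap ℝ (K →L[ℂ] K))⟩
  have h2 := IsStrictlyPositive.nonneg_add hD h1
  exact ⟨h2.nonneg, h2.isUnit⟩

theorem isUnit_and_nonneg_rpow {D : K →L[ℂ] K} (hD : 0 ≤ D) {ε : ℝ} (hε : 0 < ε) (r : ℝ) :
    0 ≤ (D + ε • (1 : K →L[ℂ] K)) ^ r ∧ IsUnit ((D + ε • (1 : K →L[ℂ] K)) ^ r) := by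
  obtain ⟨h1, h2⟩ := isUnit_add_smul_one hD hε
  exact ⟨CFC.rpow_nonneg, h2.cfcRpow r h1⟩

/-- Moving `R` onto the operators, the hypothesis says that `R M R - R D R` has non-negative
expectation in every `ρ ∈ 𝒮`. Hence the bottom of its spectrum is non-negative, and the invertible
`R` can be removed. -/
theorem le_of_forall_density {D M R : K →L[ℂ] K} (hD : 0 ≤ D) (hM : 0 ≤ M)
    (hR : IsSelfAdjoint R) (hRu : IsUnit R) {𝒮 : Set (K →L[ℂ] K)}
    (h𝒮 : 𝒮 ⊆ densityOperators K) (hA : AttainsInfSpec 𝒮)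
    (h : ∀ ρ ∈ 𝒮, sandwichTrace D (R * ρ * R) ≤ sandwichTrace M (R * ρ * R)) : D ≤ M := by
  rcases subsingleton_or_nontrivial K with hK | hK
  · exact le_of_eq (Subsingleton.elim _ _)
  -- An empty `𝒮` would give infimum `0` for `Z = 1`, whose spectrum is `{1}`.
  have hne : 𝒮.Nonempty := by
    rw [Set.nonempty_iff_ne_empty]
    rintro rfl
    have := hA 1 zero_le_one
    simp [spectrum.one_eq] at this
  have hD' : 0 ≤ R * D * R := hR.conjugate_nonneg hD
  have hM' : 0 ≤ R * M * R := hR.conjugate_nonneg hM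
  set c : ℝ := ‖R * D * R‖
  have hc : R * D * R ≤ c • (1 : K →L[ℂ] K) := by
    rw [← Algebra.algebraMap_eq_smul_one]
    exact IsSelfAdjoint.le_algebraMap_norm_self (.of_nonneg hD')
  -- `AttainsInfSpec` speaks only of positive operators, so the difference is shifted by `c = ‖R D
  -- R‖`.
  set Z := R * M * R + (c • (1 : K →L[ℂ] K) - R * D * R) with hZ
  have hZ0 : 0 ≤ Z := add_nonneg hM' (sub_nonneg.2 hc)
  have hcZ : ∀ ρ ∈ 𝒮, c ≤ (tr (ρ * Z)).re := by
    intro ρ hρ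
    obtain ⟨hρ0, hρ1⟩ := h𝒮 hρ
    have hfin : psdTrace ρ ≠ ∞ := by rw [hρ1]; exact ENNReal.one_ne_top
    rw [tr_density_mul hρ0 hfin hZ0]
    have hle := h ρ hρ
    rw [sandwichTrace_conj hD hρ0 hR, sandwichTrace_conj hM hρ0 hR] at hle
    have h1 : Z + R * D * R = R * M * R + c • 1 := by rw [hZ]; abel
    have hc1 : 0 ≤ c • (1 : K →L[ℂ] K) := hD'.trans hc
    have h2 := congrArg (fun T => sandwichTrace T ρ) h1
    simp only [sandwichTrace_add_left hZ0 hD', sandwichTrace_add_left hM' hc1] at h2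
    rw [sandwichTrace_smul_left (norm_nonneg _ : 0 ≤ c), sandwichTrace_one_left hρ0, hρ1,
      mul_one] at h2
    have hDf := sandwichTrace_ne_top hρ0 hfin hD'
    have h3 : ENNReal.ofReal c ≤ sandwichTrace Z ρ := by
      rw [← ENNReal.add_le_add_iff_right hDf, h2, add_comm]
      gcongr
    rw [← ENNReal.ofReal_le_iff_le_toReal (sandwichTrace_ne_top hρ0 hfin hZ0)]
    exact h3
  have hinf : c ≤ sInf (spectrum ℝ Z) := by
    rw [← hA Z hZ0]
    refine le_csInf (hne.image _) ?_
    rintro _ ⟨ρ, hρ, rfl⟩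
    exact hcZ ρ hρ
  have hcle : algebraMap ℝ (K →L[ℂ] K) c ≤ Z := by
    rw [algebraMap_le_iff_le_spectrum (.of_nonneg hZ0)]
    intro x hx
    exact hinf.trans (csInf_le ⟨0, fun y hy => spectrum_nonneg_of_nonneg hZ0 hy⟩ hx)
  have h0 : 0 ≤ star R * (M - D) * R := by
    rw [hR.star_eq, mul_sub, sub_mul]
    rw [Algebra.algebraMap_eq_smul_one, ← sub_nonneg, hZ] at hcle
    convert hcle using 1
    abel
  rw [hRu.star_left_conjugate_nonneg_iff] at h0
  exact sub_nonneg.1 h0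

variable {Y : Type*} [TopologicalSpace Y] [CompactSpace Y] [MeasurableSpace Y] [BorelSpace Y]

theorem le_integral_of_forall_density (ν : Measure Y) [IsFiniteMeasure ν] {B : Y → K →L[ℂ] K}
    (hB : Continuous B) (hB0 : ∀ y, 0 ≤ B y) {D R : K →L[ℂ] K} (hD : 0 ≤ D)
    (hR : IsSelfAdjoint R) (hRu : IsUnit R) {𝒮 : Set (K →L[ℂ] K)}
    (h𝒮 : 𝒮 ⊆ densityOperators K) (hA : AttainsInfSpec 𝒮)
    (h : ∀ ρ ∈ 𝒮, sandwichTrace D (R * ρ * R) ≤ ∫⁻ y, sandwichTrace (B y) (R * ρ * R) ∂ν) :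
    D ≤ ∫ y, B y ∂ν := by
  have hM := integral_operator_nonneg ν hB0
  refine le_of_forall_density hD hM hR hRu h𝒮 hA fun ρ hρ => (h ρ hρ).trans_eq ?_
  obtain ⟨hρ0, hρ1⟩ := h𝒮 hρ
  have hfin : psdTrace ρ ≠ ∞ := by rw [hρ1]; exact ENNReal.one_ne_top
  rw [sandwichTrace_conj hM hρ0 hR]
  simp only [sandwichTrace_conj (hB0 _) hρ0 hR]
  have hBi := integrable_of_continuous ν hB
  have : R * (∫ y, B y ∂ν) * R = ∫ y, R * B y * R ∂ν := by
    rw [← integral_const_mul_of_integrable hBi, ← integral_mul_const_of_integrable]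
    exact hBi.const_mul R
  rw [this]
  exact (sandwichTrace_integral ν (by fun_prop) (fun y => hR.conjugate_nonneg (hB0 y)) hρ0
    hfin).symm

end Resolvent

end WeakMean

namespace WeakMean

/-! ### The equivalences of the theorem. -/

section WeakBounds

theorem exists_forall_le_of_continuous {Y : Type*} [TopologicalSpace Y] [CompactSpace Y]
    [Nonempty Y] {β : Type*} [LinearOrder β] [TopologicalSpace β] [OrderClosedTopology β]
    {a : Y → β} (ha : Continuous a) : ∃ y₀, ∀ y, a y ≤ a y₀ := by
  obtain ⟨y₀, -, h⟩ := isCompact_univ.exists_isMaxOn Set.univ_nonempty ha.continuousOn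
  exact ⟨y₀, fun y => h (Set.mem_univ y)⟩

section Separation

variable {K : Type*} [NormedAddCommGroup K] [InnerProductSpace ℂ K] [CompleteSpace K]

theorem toReal_sandwichTrace_combo {Z ρ₁ ρ₂ : K →L[ℂ] K} (hZ : 0 ≤ Z) {a b : ℝ} (ha : 0 ≤ a)
    (hb : 0 ≤ b) (h₁ : ρ₁ ∈ densityOperators K) (h₂ : ρ₂ ∈ densityOperators K) :
    (sandwichTrace Z (a • ρ₁ + b • ρ₂)).toReal =
      a * (sandwichTrace Z ρ₁).toReal + b * (sandwichTrace Z ρ₂).toReal := by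
  have hf : ∀ {ρ}, ρ ∈ densityOperators K → sandwichTrace Z ρ ≠ ∞ := fun hρ =>
    sandwichTrace_ne_top hρ.1 (by rw [hρ.2]; exact ENNReal.one_ne_top) hZ
  have hf₁ := hf h₁
  have hf₂ := hf h₂
  rw [sandwichTrace_add_right hZ (smul_nonneg ha h₁.1) (smul_nonneg hb h₂.1),
    sandwichTrace_smul_right ha hZ h₁.1, sandwichTrace_smul_right hb hZ h₂.1,
    ENNReal.toReal_add (by finiteness) (by finiteness), ENNReal.toReal_mul, ENNReal.toReal_mul,
    ENNReal.toReal_ofReal ha, ENNReal.toReal_ofReal hb]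

variable {Y : Type*} [TopologicalSpace Y] [CompactSpace Y] [T2Space Y] [Nonempty Y]
  [MeasurableSpace Y] [BorelSpace Y]

/-- Minimax theorem for a convex set of density operators. -/
theorem exists_probabilityMeasure_le_integral {B : Y → K →L[ℂ] K} (hBc : Continuous B)
    (hB : ∀ y, 0 ≤ B y) {D R : K →L[ℂ] K} (hD : 0 ≤ D) (hR : IsSelfAdjoint R) (hRu : IsUnit R)
    {𝒮 : Set (K →L[ℂ] K)} (h𝒮 : 𝒮 ⊆ densityOperators K) (hconv : Convex ℝ 𝒮)
    (hA : AttainsInfSpec 𝒮)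
    (hcont : ∀ ρ ∈ 𝒮, Continuous fun y => (sandwichTrace (B y) (R * ρ * R)).toReal)
    (hle : ∀ ρ ∈ 𝒮, ∃ y, (sandwichTrace D (R * ρ * R)).toReal ≤
      (sandwichTrace (B y) (R * ρ * R)).toReal) :
    ∃ μ : Measure Y, IsProbabilityMeasure μ ∧ D ≤ ∫ y, B y ∂μ := by
  have hconj : ∀ {Z ρ : K →L[ℂ] K}, 0 ≤ Z → ρ ∈ 𝒮 →
      sandwichTrace Z (R * ρ * R) = sandwichTrace (R * Z * R) ρ := fun hZ hρ =>
    sandwichTrace_conj hZ (h𝒮 hρ).1 hR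
  have hne : ∀ {Z ρ : K →L[ℂ] K}, 0 ≤ Z → ρ ∈ 𝒮 → sandwichTrace Z (R * ρ * R) ≠ ∞ := by
    intro Z ρ hZ hρ
    rw [hconj hZ hρ]
    exact sandwichTrace_ne_top (h𝒮 hρ).1 (by rw [(h𝒮 hρ).2]; exact ENNReal.one_ne_top)
      (hR.conjugate_nonneg hZ)
  set 𝒢 : Set C(Y, ℝ) := {g | ∃ ρ ∈ 𝒮, ∀ y, g y = (sandwichTrace (B y) (R * ρ * R)).toReal -
    (sandwichTrace D (R * ρ * R)).toReal}
  -- By convexity a sum of two scaled elements is again a multiple of one, evaluated at the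
  -- barycentre of the two densities.
  have hM : ∀ g ∈ AddSubmonoid.closure 𝒢, g = 0 ∨ ∃ t : ℝ, 0 < t ∧ ∃ ρ ∈ 𝒮, ∀ y,
      g y = t * ((sandwichTrace (B y) (R * ρ * R)).toReal -
        (sandwichTrace D (R * ρ * R)).toReal) := by
    intro g hg
    induction hg using AddSubmonoid.closure_induction with
    | mem g hg =>
      obtain ⟨ρ, hρ, h⟩ := hg
      exact Or.inr ⟨1, one_pos, ρ, hρ, fun y => by rw [h, one_mul]⟩
    | zero => exact Or.inl rfl
    | add g₁ g₂ _ _ h₁ h₂ =>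
      rcases h₁ with rfl | ⟨t₁, ht₁, ρ₁, hρ₁, h₁⟩
      · simpa using h₂
      rcases h₂ with rfl | ⟨t₂, ht₂, ρ₂, hρ₂, h₂⟩
      · rw [add_zero]
        exact Or.inr ⟨t₁, ht₁, ρ₁, hρ₁, h₁⟩
      have ha : 0 ≤ t₁ / (t₁ + t₂) := by positivity
      have hb : 0 ≤ t₂ / (t₁ + t₂) := by positivity
      have hρ := hconv hρ₁ hρ₂ ha hb (by field_simp)
      refine Or.inr ⟨t₁ + t₂, by positivity, _, hρ, fun y => ?_⟩
      rw [ContinuousMap.add_apply, h₁, h₂, hconj (hB y) hρ, hconj hD hρ, hconj (hB y) hρ₁,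
        hconj hD hρ₁, hconj (hB y) hρ₂, hconj hD hρ₂,
        toReal_sandwichTrace_combo (hR.conjugate_nonneg hD) ha hb (h𝒮 hρ₁) (h𝒮 hρ₂),
        toReal_sandwichTrace_combo (hR.conjugate_nonneg (hB y)) ha hb (h𝒮 hρ₁) (h𝒮 hρ₂)]
      field_simp
      ring
  obtain ⟨μ, hμ, hint⟩ := exists_probabilityMeasure_integral_nonneg (AddSubmonoid.closure 𝒢) (by
    intro g hg
    rcases hM g hg with rfl | ⟨t, ht, ρ, hρ, h⟩
    · exact ⟨Classical.arbitrary Y, le_rfl⟩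
    · obtain ⟨y, hy⟩ := hle ρ hρ
      exact ⟨y, by rw [h]; exact mul_nonneg ht.le (sub_nonneg.2 hy)⟩)
  refine ⟨μ, hμ, le_integral_of_forall_density μ hBc hB hD hR hRu h𝒮 hA fun ρ hρ => ?_⟩
  have h1 := hint ⟨_, (hcont ρ hρ).sub continuous_const⟩
    (AddSubmonoid.subset_closure ⟨ρ, hρ, fun y => rfl⟩)
  simp only [ContinuousMap.coe_mk, Pi.sub_apply] at h1
  rw [integral_sub (integrable_of_continuous μ (hcont ρ hρ)) (integrable_const _),
    integral_const, probReal_univ, one_smul, sub_nonneg] at h1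
  rw [← ENNReal.ofReal_toReal (hne hD hρ)]
  refine (ENNReal.ofReal_le_ofReal h1).trans_eq ?_
  rw [ofReal_integral_eq_lintegral_ofReal (integrable_of_continuous μ (hcont ρ hρ))
    (Eventually.of_forall fun y => ENNReal.toReal_nonneg)]
  simp only [ENNReal.ofReal_toReal (hne (hB _) hρ)]

end Separation

variable {H : Type u} [NormedAddCommGroup H] [InnerProductSpace ℂ H] [CompleteSpace H]
  {Y : Type v} [TopologicalSpace Y] [CompactSpace Y] [MeasurableSpace Y] [BorelSpace Y]

theorem sandwichTrace_le_iSup_of_le_integral {A : Y → H →L[ℂ] H} (hA : ∀ y, 0 ≤ A y)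
    (hAc : Continuous A) {C : H →L[ℂ] H} {n : ℕ} {μ : Measure Y} [IsProbabilityMeasure μ]
    (h : opPow C n ≤ ∫ y, opPow (A y) n ∂μ) (X : HilbertPow H n →L[ℂ] HilbertPow H n) :
    sandwichTrace (opPow C n) X ≤ ⨆ y, sandwichTrace (opPow (A y) n) X :=
  (sandwichTrace_mono_left h X).trans
    (sandwichTrace_integral_le μ (continuous_opPow hAc n) (fun y => opPow_nonneg (hA y) n) X)

/-- The multiplicativity of traces in the tensor power, and the minimax theorem for geometric
means. -/
theorem exists_le_geomMean_of_le [T2Space Y] [Nonempty Y] {A : Y → H →L[ℂ] H}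
    (hA : ∀ y, 0 ≤ A y) {C : H →L[ℂ] H} (hC : 0 ≤ C)
    {𝒳 : (n : ℕ) → Set (HilbertPow H n →L[ℂ] HilbertPow H n)}
    (h𝒳 : ∀ n, 1 ≤ n → ∀ X ∈ 𝒳 n, 0 ≤ X)
    (hmul : ∀ n m, 1 ≤ n → 1 ≤ m → ∀ X₁ ∈ 𝒳 n, ∀ X₂ ∈ 𝒳 m, powTensor X₁ X₂ ∈ 𝒳 (n + m))
    (hcont : ∀ n, 1 ≤ n → ∀ X ∈ 𝒳 n,
      Continuous fun y => (sandwichTrace (opPow (A y) n) X).toReal)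
    (hAf : ∀ n, 1 ≤ n → ∀ X ∈ 𝒳 n, ∀ y, sandwichTrace (opPow (A y) n) X ≠ ∞)
    (hCf : ∀ n, 1 ≤ n → ∀ X ∈ 𝒳 n, sandwichTrace (opPow C n) X ≠ ∞)
    (hle : ∀ n, 1 ≤ n → ∀ X ∈ 𝒳 n, ∃ y,
      sandwichTrace (opPow C n) X ≤ sandwichTrace (opPow (A y) n) X) :
    ∃ ν : Measure Y, IsProbabilityMeasure ν ∧ ∀ n, 1 ≤ n → ∀ X ∈ 𝒳 n,
      sandwichTrace (opPow C n) X ≤ geomMean ν fun y => sandwichTrace (opPow (A y) n) X := by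
  obtain ⟨ν, hν, h⟩ := exists_le_geomMean (Y := Y) {p | ∃ n, 1 ≤ n ∧ ∃ X ∈ 𝒳 n,
      (∀ y, p.1 y = (sandwichTrace (opPow (A y) n) X).toReal) ∧
      p.2 = (sandwichTrace (opPow C n) X).toReal}
    (by
      rintro p ⟨n, hn, X, hX, h1, h2⟩ y
      rw [h1]
      exact ENNReal.toReal_nonneg)
    (by
      rintro p ⟨n, hn, X, hX, h1, h2⟩ q ⟨m, hm, X', hX', h1', h2'⟩
      refine ⟨n + m, by omega, powTensor X X', hmul n m hn hm X hX X' hX', fun y => ?_, ?_⟩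
      · rw [sandwichTrace_powTensor (hA y) (h𝒳 n hn X hX) (h𝒳 m hm X' hX'), ENNReal.toReal_mul,
          ← h1, ← h1']
        rfl
      · rw [sandwichTrace_powTensor hC (h𝒳 n hn X hX) (h𝒳 m hm X' hX'), ENNReal.toReal_mul,
          ← h2, ← h2']
        rfl)
    (by
      rintro p ⟨n, hn, X, hX, h1, h2⟩
      obtain ⟨y, hy⟩ := hle n hn X hX
      refine ⟨y, ?_⟩
      rw [h1, h2]
      exact ENNReal.toReal_mono (hAf n hn X hX y) hy)
  refine ⟨ν, hν, fun n hn X hX => ?_⟩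
  have := h (⟨_, hcont n hn X hX⟩, (sandwichTrace (opPow C n) X).toReal)
    ⟨n, hn, X, hX, fun y => rfl, rfl⟩
  simp only [ContinuousMap.coe_mk, ENNReal.ofReal_toReal (hAf n hn X hX _)] at this
  rw [ENNReal.ofReal_toReal (hCf n hn X hX)] at this
  exact this

theorem tfae_weak_bounds [T2Space Y] [Nonempty Y]
    (A : Y → (H →L[ℂ] H)) (hA : ∀ y, 0 ≤ A y) (hAc : Continuous A)
    (C : H →L[ℂ] H) (hC : 0 ≤ C)
    (𝒳 : (n : ℕ) → Set (HilbertPow H n →L[ℂ] HilbertPow H n)) (h𝒳 : TraceAssumption A C 𝒳)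
    (𝒮 : (n : ℕ) → Set (HilbertPow H n →L[ℂ] HilbertPow H n)) (δ : ℕ → ℝ)
    (h𝒮 : ∀ n, 1 ≤ n → 0 < δ n ∧ 𝒮 n ⊆ densityOperators (HilbertPow H n) ∧ Convex ℝ (𝒮 n) ∧
      AttainsInfSpec (𝒮 n) ∧ rescaled (opPow C n) (𝒮 n) (δ n) ⊆ 𝒳 n) :
    List.TFAE [
      ∀ n, 1 ≤ n → ∀ X : HilbertPow H n →L[ℂ] HilbertPow H n, 0 ≤ X →
        sandwichTrace (opPow C n) X ≤ ⨆ y, sandwichTrace (opPow (A y) n) X,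
      ∀ n, 1 ≤ n → ∀ X ∈ 𝒳 n,
        (tr (opPow C n * X)).re ≤ ⨆ y, (tr (opPow (A y) n * X)).re,
      ∀ n, 1 ≤ n → ∀ X ∈ rescaled (opPow C n) (𝒮 n) (δ n),
        (tr (opPow C n * X)).re ≤ ⨆ y, (tr (opPow (A y) n * X)).re,
      ∀ n, 1 ≤ n → ∃ μ : Measure Y, IsProbabilityMeasure μ ∧
        opPow C n ≤ ∫ y, opPow (A y) n ∂μ,
      ∃ μ : Measure Y, IsProbabilityMeasure μ ∧
        ∀ n, 1 ≤ n → opPow C n ≤ ∫ y, opPow (A y) n ∂μ,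
      ∃ ν : Measure Y, IsProbabilityMeasure ν ∧ ∀ n, 1 ≤ n → ∀ X ∈ 𝒳 n,
        ENNReal.ofReal (tr (opPow C n * X)).re ≤
          geomMean ν fun y => ENNReal.ofReal (tr (opPow (A y) n * X)).re] := by
  have hAX : ∀ n, 1 ≤ n → ∀ X ∈ 𝒳 n, ∀ y, 0 ≤ (tr (opPow (A y) n * X)).re ∧
      sandwichTrace (opPow (A y) n) X = ENNReal.ofReal (tr (opPow (A y) n * X)).re :=
    fun n hn X hX y => (h𝒳.traceClass_family n hn X hX y).sandwichTrace_eq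
      (opPow_nonneg (hA y) n) (h𝒳.nonneg n hn X hX)
  have hCX : ∀ n, 1 ≤ n → ∀ X ∈ 𝒳 n, 0 ≤ (tr (opPow C n * X)).re ∧
      sandwichTrace (opPow C n) X = ENNReal.ofReal (tr (opPow C n * X)).re :=
    fun n hn X hX => (h𝒳.traceClass_bound n hn X hX).sandwichTrace_eq
      (opPow_nonneg hC n) (h𝒳.nonneg n hn X hX)
  have hcont : ∀ n, 1 ≤ n → ∀ X ∈ 𝒳 n, Continuous fun y => (tr (opPow (A y) n * X)).re :=
    fun n hn X hX => Complex.continuous_re.comp (h𝒳.continuous_trace n hn X hX)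
  -- Continuity on a compact space makes the real supremum attained; in particular it is bounded and
  -- not the default value `0`.
  have hreal : ∀ n, 1 ≤ n → ∀ X ∈ 𝒳 n,
      ((tr (opPow C n * X)).re ≤ ⨆ y, (tr (opPow (A y) n * X)).re ↔
        ∃ y, (tr (opPow C n * X)).re ≤ (tr (opPow (A y) n * X)).re) := by
    intro n hn X hX
    obtain ⟨y₀, hy₀⟩ := exists_forall_le_of_continuous (hcont n hn X hX)
    have hb : BddAbove (Set.range fun y => (tr (opPow (A y) n * X)).re) :=
      ⟨_, Set.forall_mem_range.2 hy₀⟩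
    exact ⟨fun h => ⟨y₀, h.trans (ciSup_le hy₀)⟩, fun ⟨y, hy⟩ => hy.trans (le_ciSup hb y)⟩
  -- One value of `ε` is enough to characterise the order, here `δ n / 2`.
  have hres : ∀ n, 1 ≤ n → ∃ R : HilbertPow H n →L[ℂ] HilbertPow H n, IsSelfAdjoint R ∧ IsUnit R ∧
      ∀ ρ ∈ 𝒮 n, R * ρ * R ∈ rescaled (opPow C n) (𝒮 n) (δ n) := by
    intro n hn
    have hδ : 0 < δ n / 2 := half_pos (h𝒮 n hn).1
    obtain ⟨h1, h2⟩ := isUnit_and_nonneg_rpow (opPow_nonneg hC n) hδ (-(1 / 2))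
    exact ⟨_, .of_nonneg h1, h2, fun ρ hρ =>
      ⟨ρ, hρ, δ n / 2, ⟨hδ, half_lt_self (h𝒮 n hn).1⟩, rfl⟩⟩
  tfae_have 1 → 2 := by
    intro h n hn X hX
    rw [hreal n hn X hX]
    obtain ⟨y₀, hy₀⟩ := exists_forall_le_of_continuous (hcont n hn X hX)
    refine ⟨y₀, ?_⟩
    have h1 := h n hn X (h𝒳.nonneg n hn X hX)
    rw [(hCX n hn X hX).2] at h1
    rw [← ENNReal.ofReal_le_ofReal_iff (hAX n hn X hX y₀).1]
    refine h1.trans (iSup_le fun y => ?_)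
    rw [(hAX n hn X hX y).2]
    exact ENNReal.ofReal_le_ofReal (hy₀ y)
  tfae_have 2 → 3 := fun h n hn X hX => h n hn X ((h𝒮 n hn).2.2.2.2 hX)
  tfae_have 3 → 4 := by
    intro h n hn
    obtain ⟨R, hR, hRu, hρ𝒳⟩ := hres n hn
    obtain ⟨-, h𝒮d, h𝒮c, h𝒮a, h𝒮𝒳⟩ := h𝒮 n hn
    refine exists_probabilityMeasure_le_integral (continuous_opPow hAc n)
      (fun y => opPow_nonneg (hA y) n) (opPow_nonneg hC n) hR hRu h𝒮d h𝒮c h𝒮a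
      (fun ρ hρ => ?_) (fun ρ hρ => ?_)
    · have hX := h𝒮𝒳 (hρ𝒳 ρ hρ)
      convert hcont n hn _ hX using 2 with y
      rw [(hAX n hn _ hX y).2, ENNReal.toReal_ofReal (hAX n hn _ hX y).1]
    · have hX := h𝒮𝒳 (hρ𝒳 ρ hρ)
      obtain ⟨y, hy⟩ := (hreal n hn _ hX).1 (h n hn _ (hρ𝒳 ρ hρ))
      refine ⟨y, ?_⟩
      rwa [(hAX n hn _ hX y).2, ENNReal.toReal_ofReal (hAX n hn _ hX y).1, (hCX n hn _ hX).2,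
        ENNReal.toReal_ofReal (hCX n hn _ hX).1]
  tfae_have 4 → 1 := by
    intro h n hn X _
    obtain ⟨μ, hμ, hle⟩ := h n hn
    exact sandwichTrace_le_iSup_of_le_integral hA hAc hle X
  tfae_have 5 → 4 := fun ⟨μ, hμ, h⟩ n hn => ⟨μ, hμ, h n hn⟩
  tfae_have 2 → 6 := by
    intro h
    obtain ⟨ν, hν, h6⟩ := exists_le_geomMean_of_le (Y := Y) hA hC h𝒳.nonneg h𝒳.tensor_mem
      (fun n hn X hX => by
        convert hcont n hn X hX using 2 with y
        rw [(hAX n hn X hX y).2, ENNReal.toReal_ofReal (hAX n hn X hX y).1])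
      (fun n hn X hX y => by rw [(hAX n hn X hX y).2]; exact ENNReal.ofReal_ne_top)
      (fun n hn X hX => by rw [(hCX n hn X hX).2]; exact ENNReal.ofReal_ne_top)
      (fun n hn X hX => by
        obtain ⟨y, hy⟩ := (hreal n hn X hX).1 (h n hn X hX)
        refine ⟨y, ?_⟩
        rw [(hCX n hn X hX).2, (hAX n hn X hX y).2]
        exact ENNReal.ofReal_le_ofReal hy)
    refine ⟨ν, hν, fun n hn X hX => ?_⟩
    have := h6 n hn X hX
    rw [(hCX n hn X hX).2] at this
    simpa only [(hAX n hn X hX _).2] using this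
  tfae_have 6 → 5 := by
    rintro ⟨ν, hν, h⟩
    refine ⟨ν, hν, fun n hn => ?_⟩
    obtain ⟨R, hR, hRu, hρ𝒳⟩ := hres n hn
    obtain ⟨-, h𝒮d, h𝒮c, h𝒮a, h𝒮𝒳⟩ := h𝒮 n hn
    refine le_integral_of_forall_density ν (continuous_opPow hAc n)
      (fun y => opPow_nonneg (hA y) n) (opPow_nonneg hC n) hR hRu h𝒮d h𝒮a fun ρ hρ => ?_
    have hX := h𝒮𝒳 (hρ𝒳 ρ hρ)
    rw [(hCX n hn _ hX).2]
    simp only [(hAX n hn _ hX _).2]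
    exact (h n hn _ hX).trans
      (geomMean_le_lintegral ν (hcont n hn _ hX).measurable.ennreal_ofReal)
  tfae_finish

end WeakBounds

end WeakMean

namespace WeakMean

open ContinuousLinearMap

/-! ### Traces of tensor powers. -/

section TracePow

variable {H : Type u} [NormedAddCommGroup H] [InnerProductSpace ℂ H] [CompleteSpace H]

/-- The identification of `H` with its first tensor power. -/
theorem exists_hilbertBasis_pow_one {ι : Type*} (b : HilbertBasis ι ℂ H) :
    ∃ d : HilbertBasis ι ℂ (HilbertPow H 1), ∀ (A : H →L[ℂ] H) i,
      ‖opPow A 1 (d i)‖ = ‖A (b i)‖ := by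
  let e : AlgPow H 0 := (algZero H).symm 1
  have he : ‖e‖ = 1 := by
    rw [LinearIsometryEquiv.norm_map, norm_one]
  have hee : ⟪e, e⟫_ℂ = 1 := by
    rw [LinearIsometryEquiv.inner_map_map]; simp
  let f : H →ₗ[ℂ] HilbertPow H 1 :=
    (Completion.toComplₗᵢ (𝕜 := ℂ) (E := AlgPow H 1)).toLinearMap ∘ₗ
      ((algSucc H 0).symm.toLinearEquiv.toLinearMap ∘ₗ TensorProduct.mk ℂ (AlgPow H 0) H e)
  have hf : ∀ x : H, f x = (((algSucc H 0).symm (e ⊗ₜ x) : AlgPow H 1) : HilbertPow H 1) :=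
    fun x => rfl
  have hin : ∀ x y, ⟪f x, f y⟫_ℂ = ⟪x, y⟫_ℂ := by
    intro x y
    rw [hf, hf, Completion.inner_coe, LinearIsometryEquiv.inner_map_map, TensorProduct.inner_tmul,
      hee, one_mul]
  let g : H →ₗᵢ[ℂ] HilbertPow H 1 := f.isometryOfInner hin
  -- The range of an isometry from a complete space is closed, and it contains all `a ⊗ x` since `a`
  -- is a scalar multiple of the unit vector `e`.
  have hsurj : ∀ z : HilbertPow H 1, z ∈ LinearMap.range f := by
    intro z
    have hclosed : IsClosed (Set.range g) := g.isometry.isClosedEmbedding.isClosed_range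
    induction z using Completion.induction_on with
    | hp => exact hclosed
    | ih z =>
      obtain ⟨z, rfl⟩ := (algSucc H 0).symm.surjective z
      induction z using TensorProduct.induction_on with
      | zero => exact ⟨0, by simp [hf]⟩
      | add x y hx hy =>
        rw [map_add, Completion.coe_add]
        exact Submodule.add_mem _ hx hy
      | tmul a x =>
        refine ⟨algZero H a • x, ?_⟩
        rw [hf, ← TensorProduct.smul_tmul]
        have : algZero H a • e = a := by
          apply (algZero H).injective
          simp [e]
        rw [this]
  have hA : ∀ (A : H →L[ℂ] H) x, opPow A 1 (f x) = f (A x) := by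
    intro A x
    rw [hf, hf, opPow, completion_apply_coe, algOpPow_succ_apply, TensorProduct.mapL_tmul]
    rfl
  have ho : Orthonormal ℂ fun i => f (b i) := b.orthonormal.comp_linearIsometry g
  refine ⟨HilbertBasis.mk ho fun z _ => ?_, fun A i => ?_⟩
  · obtain ⟨x, rfl⟩ := hsurj z
    have hle : (Submodule.span ℂ (Set.range b)).topologicalClosure ≤
        (Submodule.span ℂ (Set.range fun i => f (b i))).topologicalClosure.comap f := by
      refine Submodule.topologicalClosure_minimal _ ?_
        ((Submodule.isClosed_topologicalClosure _).preimage g.continuous)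
      rw [Submodule.span_le]
      rintro _ ⟨i, rfl⟩
      exact Submodule.le_topologicalClosure _ (Submodule.subset_span ⟨i, rfl⟩)
    rw [b.dense_span] at hle
    exact hle (Submodule.mem_top (x := x))
  · rw [HilbertBasis.coe_mk, hA]
    exact g.norm_map _

theorem hsSq_opPow_one (A : H →L[ℂ] H) : hsSq (opPow A 1) = hsSq A := by
  obtain ⟨d, hd⟩ := exists_hilbertBasis_pow_one (stdBasis H)
  rw [hsSq_eq_tsum d, hsSq]
  refine tsum_congr fun i => ?_
  rw [← ofReal_norm, hd, ofReal_norm]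

/-- Multiplicativity of traces with test operator `1`. It keeps tensor powers of densities within
the density operators. -/
theorem psdTrace_opPow {A : H →L[ℂ] H} (hA : 0 ≤ A) {n : ℕ} (hn : 1 ≤ n) :
    psdTrace (opPow A n) = psdTrace A ^ n := by
  have h1 : ∀ n, sandwichTrace (opPow A n) 1 = psdTrace (opPow A n) := fun n => by
    rw [sandwichTrace_comm (opPow_nonneg hA n) zero_le_one,
      sandwichTrace_one_left (opPow_nonneg hA n)]
  have hb : psdTrace (opPow A 1) = psdTrace A := by
    have hs : opPow A 1 = star (opPow (CFC.sqrt A) 1) * opPow (CFC.sqrt A) 1 := by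
      rw [← opPow_star, isSelfAdjoint_sqrt, ← opPow_mul, CFC.sqrt_mul_sqrt_self A]
    rw [hs, psdTrace_star_mul_self, hsSq_opPow_one, psdTrace_eq_hsSq_sqrt hA]
  induction n, hn using Nat.le_induction with
  | base => rw [hb, pow_one]
  | succ n _ ih =>
    rw [← h1, ← powTensor_one, sandwichTrace_powTensor hA zero_le_one zero_le_one, h1, h1, ih, hb,
      pow_succ]

theorem psdTrace_opPow_of_mem {ρ : H →L[ℂ] H} (hρ : ρ ∈ densityOperators H) {n : ℕ} (hn : 1 ≤ n) :
    psdTrace (opPow ρ n) = 1 := by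
  rw [psdTrace_opPow hρ.1 hn, hρ.2, one_pow]

end TracePow

/-! ### Continuity of traces on density operators, and rank-one tests. -/

section Continuity

/-- `f = M - g` is upper semicontinuous because `g` is lower semicontinuous. -/
theorem continuous_of_add_eq_const {Y : Type*} [TopologicalSpace Y] {f g : Y → ℝ≥0∞} {M : ℝ≥0∞}
    (hM : M ≠ ∞) (hf : LowerSemicontinuous f) (hg : LowerSemicontinuous g)
    (hfg : ∀ y, f y + g y = M) : Continuous f := by
  have hft : ∀ y, f y ≠ ∞ := fun y => ne_top_of_le_ne_top hM ((hfg y) ▸ le_self_add)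
  have hgt : ∀ y, g y ≠ ∞ := fun y => ne_top_of_le_ne_top hM ((hfg y) ▸ le_add_self)
  rw [continuous_iff_lower_upperSemicontinuous]
  refine ⟨hf, upperSemicontinuous_iff_isOpen_preimage.2 fun b => ?_⟩
  rcases lt_or_ge M b with hb | hb
  · convert isOpen_univ
    ext y
    simp only [Set.mem_preimage, Set.mem_Iio, Set.mem_univ, iff_true]
    exact (hfg y ▸ le_self_add : f y ≤ M).trans_lt hb
  · convert lowerSemicontinuous_iff_isOpen_preimage.1 hg (M - b) using 1
    ext y
    simp only [Set.mem_preimage, Set.mem_Iio, Set.mem_Ioi]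
    rw [ENNReal.sub_lt_iff_lt_left (ne_top_of_le_ne_top hM hb) hb, ← hfg y,
      ENNReal.add_lt_add_iff_right (hgt y)]

variable {K : Type*} [NormedAddCommGroup K] [InnerProductSpace ℂ K] [CompleteSpace K]

theorem lowerSemicontinuous_sandwichTrace {Y : Type*} [TopologicalSpace Y] {F : Y → K →L[ℂ] K}
    (hF : Continuous F) (X : K →L[ℂ] K) : LowerSemicontinuous fun y => sandwichTrace (F y) X := by
  simp only [sandwichTrace_eq_tsum]
  refine lowerSemicontinuous_tsum fun i => Continuous.lowerSemicontinuous ?_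
  refine ENNReal.continuous_ofReal.comp (Complex.continuous_re.comp ?_)
  exact continuous_const.inner (hF.clm_apply continuous_const)

theorem le_norm_smul_one {X : K →L[ℂ] K} (hX : 0 ≤ X) : X ≤ ‖X‖ • (1 : K →L[ℂ] K) := by
  rw [← Algebra.algebraMap_eq_smul_one]
  exact IsSelfAdjoint.le_algebraMap_norm_self (.of_nonneg hX)

theorem exists_test_smul {X : K →L[ℂ] K} (hX : 0 ≤ X) :
    ∃ T : K →L[ℂ] K, 0 ≤ T ∧ T ≤ 1 ∧ ‖X‖ • T = X := by
  rcases eq_or_ne X 0 with rfl | hX0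
  · exact ⟨0, le_rfl, zero_le_one, by simp⟩
  · have hn : 0 < ‖X‖ := norm_pos_iff.2 hX0
    refine ⟨‖X‖⁻¹ • X, smul_nonneg (by positivity) hX, ?_, ?_⟩
    · have := smul_le_smul_of_nonneg_left (le_norm_smul_one hX) (inv_nonneg.2 hn.le)
      rwa [smul_smul, inv_mul_cancel₀ hn.ne', one_smul] at this
    · rw [smul_smul, mul_inv_cancel₀ hn.ne', one_smul]

/-- For density operators, convergence in operator norm implies convergence of the traces against
every bounded operator. -/
theorem continuous_sandwichTrace_density {Y : Type*} [TopologicalSpace Y] {F : Y → K →L[ℂ] K}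
    (hF : Continuous F) (hF1 : ∀ y, F y ∈ densityOperators K) {X : K →L[ℂ] K} (hX : 0 ≤ X) :
    Continuous fun y => sandwichTrace (F y) X := by
  -- Since `Tr F y = 1`, the traces against `X` and `‖X‖ • 1 - X` add up to the constant `‖X‖`.
  refine continuous_of_add_eq_const (M := ENNReal.ofReal ‖X‖) ENNReal.ofReal_ne_top
    (lowerSemicontinuous_sandwichTrace hF X)
    (lowerSemicontinuous_sandwichTrace hF (‖X‖ • 1 - X)) fun y => ?_
  rw [← sandwichTrace_add_right (hF1 y).1 hX (sub_nonneg.2 (le_norm_smul_one hX)),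
    add_sub_cancel, sandwichTrace_smul_right (norm_nonneg _) (hF1 y).1 zero_le_one,
    sandwichTrace_comm (hF1 y).1 zero_le_one, sandwichTrace_one_left (hF1 y).1, (hF1 y).2, mul_one]

/-- Parseval for `√B x`. Rank-one test operators read off the quadratic form of `B`, hence the
operator order. -/
theorem sandwichTrace_rankOne {B : K →L[ℂ] K} (hB : 0 ≤ B) (x : K) :
    0 ≤ InnerProductSpace.rankOne ℂ x x ∧
    sandwichTrace B (InnerProductSpace.rankOne ℂ x x) = ENNReal.ofReal (⟪x, B x⟫_ℂ).re := by
  have h0 : 0 ≤ InnerProductSpace.rankOne ℂ x x :=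
    (nonneg_iff_isPositive _).2 (InnerProductSpace.isPositive_rankOne_self x)
  refine ⟨h0, ?_⟩
  rw [sandwichTrace_comm hB h0, sandwichTrace]
  have h1 : ENNReal.ofReal (⟪x, B x⟫_ℂ).re = ‖CFC.sqrt B x‖ₑ ^ 2 := by
    rw [← ofReal_norm, ← ENNReal.ofReal_pow (norm_nonneg _), norm_sq_eq_re_inner,
      isSelfAdjoint_sqrt, CFC.sqrt_mul_sqrt_self B]
  have hs : adjoint (CFC.sqrt B) = CFC.sqrt B := isSelfAdjoint_sqrt B
  rw [h1, ← tsum_enorm_inner_sq (stdBasis K)]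
  refine tsum_congr fun i => ?_
  rw [mul_apply_eq_comp, mul_apply_eq_comp, ← adjoint_inner_left, hs,
    InnerProductSpace.rankOne_apply, inner_smul_right, ← ofReal_norm,
    ← ENNReal.ofReal_pow (norm_nonneg _)]
  congr 1
  have h2 : ⟪CFC.sqrt B (stdBasis K i), x⟫_ℂ = ⟪stdBasis K i, CFC.sqrt B x⟫_ℂ := by
    conv_lhs => rw [← hs]
    exact adjoint_inner_left _ _ _
  rw [← adjoint_inner_left (CFC.sqrt B), hs, h2, ← inner_conj_symm (CFC.sqrt B x), mul_comm,
    Complex.mul_conj, Complex.ofReal_re, Complex.normSq_eq_norm_sq]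

end Continuity

/-! ### The equivalences of the corollary. -/

section Dominated

variable {H : Type u} [NormedAddCommGroup H] [InnerProductSpace ℂ H] [CompleteSpace H]

/-- Tensor powers of a test. -/
theorem exists_test_pow {n : ℕ} {T : HilbertPow H n →L[ℂ] HilbertPow H n}
    (hT : 0 ≤ T) (hT1 : T ≤ 1) {k : ℕ} (hk : 1 ≤ k) :
    ∃ N, N = k * n ∧ ∃ T' : HilbertPow H N →L[ℂ] HilbertPow H N, 0 ≤ T' ∧ T' ≤ 1 ∧
      ∀ B : H →L[ℂ] H, 0 ≤ B →
        sandwichTrace (opPow B N) T' = sandwichTrace (opPow B n) T ^ k := by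
  induction k, hk using Nat.le_induction with
  | base => exact ⟨n, by simp, T, hT, hT1, fun B _ => by simp⟩
  | succ k _ ih =>
    obtain ⟨N, rfl, T', h0, h1, h⟩ := ih
    -- Leaving the exponent `N` existential avoids transporting operators along `k * n + n = (k + 1)
    -- * n`.
    refine ⟨k * n + n, by ring, powTensor T' T, powTensor_nonneg h0 hT,
      powTensor_le_one h0 h1 hT hT1, fun B hB => ?_⟩
    rw [sandwichTrace_powTensor hB h0 hT, h B hB, pow_succ]

/-- The tensor power trick: apply the hypothesis to the `k`-th tensor power of `T` and take `k`-th
roots. The factor left over is at most `exp (n ε)` for large `k`, because `κ` grows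
subexponentially. -/
theorem le_iSup_of_mem_dominatedOperators {R : Set (H →L[ℂ] H)} (hR : R ⊆ densityOperators H)
    {C : H →L[ℂ] H} (hC : C ∈ dominatedOperators R) {n : ℕ} (hn : 1 ≤ n)
    {T : HilbertPow H n →L[ℂ] HilbertPow H n} (hT : 0 ≤ T) (hT1 : T ≤ 1) :
    sandwichTrace (opPow C n) T ≤ ⨆ ω ∈ R, sandwichTrace (opPow ω n) T := by
  obtain ⟨hC0, κ, hκ, hle, hlim⟩ := hC
  set s := ⨆ ω ∈ R, sandwichTrace (opPow ω n) T with hs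
  have key : ∀ ε : ℝ, 0 < ε →
      sandwichTrace (opPow C n) T ≤ ENNReal.ofReal (Real.exp (n * ε)) * s := by
    intro ε hε
    have hev : ∀ᶠ N : ℕ in atTop, ((1 / (N : ℝ) * Real.log (κ N) : ℝ) : EReal) < (ε : EReal) :=
      eventually_lt_of_limsup_lt (hlim.trans_lt (by exact_mod_cast hε))
    obtain ⟨k₀, hk₀⟩ := eventually_atTop.1 hev
    obtain ⟨N, hN, T', h0, h1, h⟩ := exists_test_pow hT hT1 (k := k₀ + 1) (by omega)
    have hNk : k₀ ≤ N := by rw [hN]; nlinarith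
    have hN1 : 1 ≤ N := by rw [hN]; nlinarith
    have hN0 : (0 : ℝ) < N := by exact_mod_cast hN1
    have hκN : κ N ≤ Real.exp (N * ε) := by
      have h2 := EReal.coe_lt_coe_iff.1 (hk₀ N hNk)
      rw [one_div, inv_mul_lt_iff₀ hN0] at h2
      rw [← Real.log_le_iff_le_exp (hκ N hN1)]
      exact h2.le
    have h3 := hle N hN1 T' h0 h1
    rw [h C hC0] at h3
    have h4 : ⨆ ω ∈ R, sandwichTrace (opPow ω N) T' ≤ s ^ (k₀ + 1) := by
      refine iSup₂_le fun ω hω => ?_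
      rw [h ω (hR hω).1]
      exact pow_le_pow_left₀ zero_le (le_iSup₂ (f := fun ω _ => sandwichTrace (opPow ω n) T) ω hω) _
    have h5 : ENNReal.ofReal (κ N) ≤ ENNReal.ofReal (Real.exp (n * ε)) ^ (k₀ + 1) := by
      rw [← ENNReal.ofReal_pow (Real.exp_pos _).le, ← Real.exp_nat_mul]
      refine ENNReal.ofReal_le_ofReal (hκN.trans_eq ?_)
      rw [hN]
      push_cast
      ring_nf
    have h6 := h3.trans (mul_le_mul' h5 h4)
    rw [← mul_pow] at h6
    exact (ENNReal.pow_le_pow_left_iff (by omega)).1 h6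
  -- The scalar factor tends to `1 ≠ 0`, so an infinite `s` needs no separate argument.
  have hlim0 : Tendsto (fun j : ℕ => ENNReal.ofReal (Real.exp (n * (1 / ((j : ℝ) + 1)))) * s) atTop
      (nhds (1 * s)) := by
    refine ENNReal.Tendsto.mul_const ?_ (Or.inl one_ne_zero)
    have h1 : Tendsto (fun j : ℕ => Real.exp (n * (1 / ((j : ℝ) + 1)))) atTop (nhds 1) := by
      have := (Real.continuous_exp.tendsto _).comp
        (tendsto_one_div_add_atTop_nhds_zero_nat.const_mul (n : ℝ))
      simpa [Function.comp_def] using this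
    simpa using ENNReal.tendsto_ofReal h1
  rw [one_mul] at hlim0
  exact ge_of_tendsto' hlim0 fun j => key _ (by positivity)

theorem tfae_dominated (R : Set (H →L[ℂ] H)) (hR : R ⊆ densityOperators H) (hRc : IsCompact R)
    (hRn : R.Nonempty) (C : H →L[ℂ] H) (hC : 0 ≤ C) :
    List.TFAE [
      C ∈ dominatedOperators R,
      ∀ n, 1 ≤ n → ∀ T : HilbertPow H n →L[ℂ] HilbertPow H n, 0 ≤ T → T ≤ 1 →
        sandwichTrace (opPow C n) T ≤ ⨆ ω ∈ R, sandwichTrace (opPow ω n) T,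
      ∃ μ : Measure R, IsProbabilityMeasure μ ∧
        ∀ n, 1 ≤ n → opPow C n ≤ ∫ ω, opPow (ω : H →L[ℂ] H) n ∂μ,
      ∃ ν : Measure R, IsProbabilityMeasure ν ∧
        ∀ n, 1 ≤ n → ∀ X : HilbertPow H n →L[ℂ] HilbertPow H n, 0 ≤ X →
          sandwichTrace (opPow C n) X ≤
            geomMean ν fun ω => sandwichTrace (opPow (ω : H →L[ℂ] H) n) X] := by
  have : CompactSpace R := isCompact_iff_compactSpace.1 hRc
  have : Nonempty R := hRn.to_subtype
  have hval : Continuous fun ω : R => (ω : H →L[ℂ] H) := continuous_subtype_val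
  have h0 : ∀ ω : R, 0 ≤ (ω : H →L[ℂ] H) := fun ω => (hR ω.2).1
  have hdens : ∀ n, 1 ≤ n → ∀ ω : R, opPow (ω : H →L[ℂ] H) n ∈ densityOperators (HilbertPow H n) :=
    fun n hn ω => ⟨opPow_nonneg (h0 ω) n, psdTrace_opPow_of_mem (hR ω.2) hn⟩
  have hcont : ∀ n, 1 ≤ n → ∀ X : HilbertPow H n →L[ℂ] HilbertPow H n, 0 ≤ X →
      Continuous fun ω : R => sandwichTrace (opPow (ω : H →L[ℂ] H) n) X := fun n hn X hX =>
    continuous_sandwichTrace_density (continuous_opPow hval n) (hdens n hn) hX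
  have hfin : ∀ n, 1 ≤ n → ∀ X : HilbertPow H n →L[ℂ] HilbertPow H n, 0 ≤ X → ∀ ω : R,
      sandwichTrace (opPow (ω : H →L[ℂ] H) n) X ≠ ∞ := by
    intro n hn X hX ω
    have hω := hdens n hn ω
    rw [sandwichTrace_comm hω.1 hX]
    exact sandwichTrace_ne_top hω.1 (by rw [hω.2]; exact ENNReal.one_ne_top) hX
  tfae_have 1 → 2 := fun h n hn T hT hT1 => le_iSup_of_mem_dominatedOperators hR h hn hT hT1
  tfae_have 2 → 1 := by
    intro h
    refine ⟨hC, fun _ => 1, fun _ _ => one_pos, fun n hn T hT hT1 => ?_, ?_⟩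
    · rw [ENNReal.ofReal_one, one_mul]
      exact h n hn T hT hT1
    · simp
  tfae_have 2 → 4 := by
    intro h
    -- Both sides scale with `X`, so normalising to a test loses nothing, and the supremum is
    -- attained on the compact `R`.
    have hle : ∀ n, 1 ≤ n → ∀ X : HilbertPow H n →L[ℂ] HilbertPow H n, 0 ≤ X → ∃ ω : R,
        sandwichTrace (opPow C n) X ≤ sandwichTrace (opPow (ω : H →L[ℂ] H) n) X := by
      intro n hn X hX
      obtain ⟨T, hT, hT1, hXT⟩ := exists_test_smul hX
      obtain ⟨ω₀, hω₀⟩ := exists_forall_le_of_continuous (hcont n hn T hT)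
      have h1 : sandwichTrace (opPow C n) T ≤ sandwichTrace (opPow (ω₀ : H →L[ℂ] H) n) T :=
        (h n hn T hT hT1).trans (iSup₂_le fun ω hω => hω₀ ⟨ω, hω⟩)
      refine ⟨ω₀, ?_⟩
      have h2 := sandwichTrace_smul_right (norm_nonneg X) (opPow_nonneg hC n) hT
      have h3 := sandwichTrace_smul_right (norm_nonneg X) (opPow_nonneg (h0 ω₀) n) hT
      rw [hXT] at h2 h3
      rw [h2, h3]
      exact mul_le_mul' le_rfl h1
    obtain ⟨ν, hν, h4⟩ := exists_le_geomMean_of_le (Y := R) h0 hC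
      (𝒳 := fun n => {X | 0 ≤ X}) (fun n _ X hX => hX)
      (fun n m _ _ X hX X' hX' => powTensor_nonneg hX hX')
      (fun n hn X hX => ENNReal.continuousOn_toReal.comp_continuous (hcont n hn X hX)
        fun ω => hfin n hn X hX ω)
      hfin
      (fun n hn X hX => by
        obtain ⟨ω, hω⟩ := hle n hn X hX
        -- Nothing is assumed about the trace of `C`; finiteness comes from the bound by a density
        -- operator.
        exact ne_top_of_le_ne_top (hfin n hn X hX ω) hω)
      hle
    exact ⟨ν, hν, h4⟩
  tfae_have 4 → 3 := by
    rintro ⟨ν, hν, h⟩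
    refine ⟨ν, hν, fun n hn => ?_⟩
    have hFc := continuous_opPow hval n
    have hF0 : ∀ ω : R, 0 ≤ opPow (ω : H →L[ℂ] H) n := fun ω => opPow_nonneg (h0 ω) n
    have hI := integral_operator_nonneg ν hF0
    rw [← sub_nonneg, nonneg_iff_isPositive, isPositive_def']
    refine ⟨(IsSelfAdjoint.of_nonneg hI).sub (.of_nonneg (opPow_nonneg hC n)), fun x => ?_⟩
    have hx0 := (sandwichTrace_rankOne (opPow_nonneg hC n) x).1
    have h1 := (h n hn _ hx0).trans (geomMean_le_lintegral ν (hcont n hn _ hx0).measurable)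
    rw [(sandwichTrace_rankOne (opPow_nonneg hC n) x).2] at h1
    simp only [(sandwichTrace_rankOne (hF0 _) x).2] at h1
    rw [← ofReal_re_inner_integral ν hFc hF0,
      ENNReal.ofReal_le_ofReal_iff (re_inner_nonneg hI x)] at h1
    rw [reApplyInnerSelf_apply, ← inner_re_symm, sub_apply, inner_sub_right, map_sub]
    exact sub_nonneg.2 h1
  tfae_have 3 → 2 := by
    rintro ⟨μ, hμ, h⟩ n hn T hT hT1
    rw [iSup_subtype']
    exact sandwichTrace_le_iSup_of_le_integral h0 hval (h n hn) T
  tfae_finish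

end Dominated

end WeakMean

theorem mainTheorem8 {H : Type u} [NormedAddCommGroup H] [InnerProductSpace ℂ H]
    [CompleteSpace H] :
    (∀ {Y : Type v} [TopologicalSpace Y] [CompactSpace Y] [T2Space Y] [Nonempty Y]
        [MeasurableSpace Y] [BorelSpace Y]
        (A : Y → (H →L[ℂ] H)) (_ : ∀ y, 0 ≤ A y) (_ : Continuous A)
        (C : H →L[ℂ] H) (_ : 0 ≤ C)
        (𝒳 : (n : ℕ) → Set (HilbertPow H n →L[ℂ] HilbertPow H n)) (_ : TraceAssumption A C 𝒳)
        (_ : ∀ n, 1 ≤ n → CharacterizesOrder (𝒳 n))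
        (𝒮 : (n : ℕ) → Set (HilbertPow H n →L[ℂ] HilbertPow H n)) (δ : ℕ → ℝ)
        (_ : ∀ n, 1 ≤ n → 0 < δ n ∧ 𝒮 n ⊆ densityOperators (HilbertPow H n) ∧ Convex ℝ (𝒮 n) ∧
          AttainsInfSpec (𝒮 n) ∧ rescaled (opPow C n) (𝒮 n) (δ n) ⊆ 𝒳 n),
      List.TFAE [
        ∀ n, 1 ≤ n → ∀ X : HilbertPow H n →L[ℂ] HilbertPow H n, 0 ≤ X →
          sandwichTrace (opPow C n) X ≤ ⨆ y, sandwichTrace (opPow (A y) n) X,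
        ∀ n, 1 ≤ n → ∀ X ∈ 𝒳 n,
          (tr (opPow C n * X)).re ≤ ⨆ y, (tr (opPow (A y) n * X)).re,
        ∀ n, 1 ≤ n → ∀ X ∈ rescaled (opPow C n) (𝒮 n) (δ n),
          (tr (opPow C n * X)).re ≤ ⨆ y, (tr (opPow (A y) n * X)).re,
        ∀ n, 1 ≤ n → ∃ μ : Measure Y, IsProbabilityMeasure μ ∧
          opPow C n ≤ ∫ y, opPow (A y) n ∂μ,
        ∃ μ : Measure Y, IsProbabilityMeasure μ ∧
          ∀ n, 1 ≤ n → opPow C n ≤ ∫ y, opPow (A y) n ∂μ,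
        ∃ ν : Measure Y, IsProbabilityMeasure ν ∧ ∀ n, 1 ≤ n → ∀ X ∈ 𝒳 n,
          ENNReal.ofReal (tr (opPow C n * X)).re ≤
            geomMean ν fun y => ENNReal.ofReal (tr (opPow (A y) n * X)).re]) ∧
    (∀ (R : Set (H →L[ℂ] H)) (_ : R ⊆ densityOperators H) (_ : IsCompact R) (_ : R.Nonempty)
        (C : H →L[ℂ] H) (_ : 0 ≤ C),
      List.TFAE [
        C ∈ dominatedOperators R,
        ∀ n, 1 ≤ n → ∀ T : HilbertPow H n →L[ℂ] HilbertPow H n, 0 ≤ T → T ≤ 1 →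
          sandwichTrace (opPow C n) T ≤ ⨆ ω ∈ R, sandwichTrace (opPow ω n) T,
        ∃ μ : Measure R, IsProbabilityMeasure μ ∧
          ∀ n, 1 ≤ n → opPow C n ≤ ∫ ω, opPow (ω : H →L[ℂ] H) n ∂μ,
        ∃ ν : Measure R, IsProbabilityMeasure ν ∧
          ∀ n, 1 ≤ n → ∀ X : HilbertPow H n →L[ℂ] HilbertPow H n, 0 ≤ X →
            sandwichTrace (opPow C n) X ≤
              geomMean ν fun ω => sandwichTrace (opPow (ω : H →L[ℂ] H) n) X]) := by
  refine ⟨?_, ?_⟩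
  · intro Y _ _ _ _ _ _ A hA hAc C hC 𝒳 h𝒳 _ 𝒮 δ h𝒮
    exact tfae_weak_bounds A hA hAc C hC 𝒳 h𝒳 𝒮 δ h𝒮
  · intro R hR hRc hRn C hC
    exact tfae_dominated R hR hRc hRn C hC
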